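/- Let $\rho>0$ and let $G:\,]0,\infty[\,\to\mathbb R$ be completely monotone (i.e. $C^\infty$ with $(-1)^nG^{(n)}(t)\ge 0$ for all $n\ge 0$, $t>0$), integrable on $]0,1]$, with positive equilibrium modulus $G_\infty:=\lim_{t\to\infty}G(t)>0$. For $\operatorname{Re}p>0$ put $\mathcal Q(p)=p\int_0^\infty e^{-pt}G(t)\,dt$ and $$B(p)=p\,\frac{\rho^{1/2}}{\mathcal Q(p)^{1/2}}$$ (principal square root). A Bernstein function is a differentiable $g:\,]0,\infty[\,\to[0,\infty[$ with $g'$ completely monotone; a complete Bernstein function is a function $f$ of the form $f(x)=x^2\int_0^\infty e^{-xt}g(t)\,dt$, $x>0$, with $g$ a Bernstein function. Then the following hold. 1. For $\operatorname{Re} p>0$ the integral defining $\mathcal Q(p)$ converges absolutely and $\mathcal Q(p)\in\mathbb C\setminus\,]-\infty,0]$. On $]0,\infty[$, $B$ is a real-valued complete Bernstein function, and $B(p)\to0$ as $p\to0+$. 2. The limit $G_0:=\lim_{t\to0+}G(t)\in\,]0,\infty]$ exists. With $c_0:=\sqrt{G_0/\rho}\in\,]0,\infty]$ (and $1/c_0:=0$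 if $c_0=\infty$), $B(p)/p\to 1/c_0$ as $p\to\infty$ along the reals, and there is a positive measure $\nu$ on $]0,\infty[$ with $\int_{]0,\infty[}\frac{\nu(dr)}{1+r}<\infty$ such that $$B(p)=\frac{p}{c_0}+b(p)\quad(\operatorname{Re}p>0),\qquad b(p):=p\int_{]0,\infty[}\frac{\nu(dr)}{p+r}.$$ The integral in $b$ converges absolutely and $b$ is analytic on $\mathbb C\setminus\,]-\infty,0]$, so that $p/c_0+b(p)$ is the analytic continuation of $B$ there; put $b(0):=0$. 3. $b(p)=o(p)$ as $|p|\to\infty$ with $\operatorname{Re}p\ge0$, and $\operatorname{Re}b(p)\ge 0$ whenever $\operatorname{Re}p\ge0$. 4. For $\operatorname{Re}p\ge0$, $p\ne0$, the attenuation function $\mathcal A:=\operatorname{Re}b$ and the dispersion function $\mathcal D:=-\operatorname{Im}b$ are given by the absolutely convergent integrals $$\mathcal A(p)=\int_{]0,\infty[}\frac{|p|^2+r\operatorname{Re}p}{|p+r|^2}\,\nu(dr),\qquad \mathcal D(p)=-\operatorname{Im}p\int_{]0,\infty[}\frac{r}{|p+r|^2}\,\nu(dr).$$ In particular, for real $\omega\ne0$,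 $$\mathcal A(-i\omega)=\omega^2\int_{]0,\infty[}\frac{\nu(dr)}{\omega^2+r^2},\qquad \mathcal D(-i\omega)=\omega\int_{]0,\infty[}\frac{r\,\nu(dr)}{\omega^2+r^2}.$$ -/

import Mathlib

open Set Filter Topology MeasureTheory Asymptotics
open scoped ENNReal

noncomputable section

namespace Viscoelastic

/-- `f` is completely monotone on `]0,∞[`: smooth there, with
`(-1)^n f^(n)(t) ≥ 0` for all `n` and all `t > 0`. -/
def IsCompletelyMonotone (f : ℝ → ℝ) : Prop :=
  ContDiffOn ℝ (⊤ : ℕ∞) f (Ioi 0) ∧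
    ∀ n : ℕ, ∀ t : ℝ, 0 < t → 0 ≤ (-1) ^ n * iteratedDeriv n f t

/-- `f` is a Bernstein function on `]0,∞[`: differentiable, non-negative, with completely
monotone derivative. -/
def IsBernstein (f : ℝ → ℝ) : Prop :=
  DifferentiableOn ℝ f (Ioi 0) ∧ (∀ t : ℝ, 0 < t → 0 ≤ f t) ∧ IsCompletelyMonotone (deriv f)

/-- The Laplace transform `∫₀^∞ exp (-p t) g(t) dt` at a real point `p`. -/
def realLaplace (g : ℝ → ℝ) (p : ℝ) : ℝ :=
  ∫ t in Ioi (0 : ℝ), Real.exp (-(p * t)) * g t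

/-- The Laplace transform `∫₀^∞ exp (-p t) g(t) dt` at a complex point `p`. -/
def laplace (g : ℝ → ℝ) (p : ℂ) : ℂ :=
  ∫ t in Ioi (0 : ℝ), Complex.exp (-(p * (t : ℂ))) * ((g t : ℝ) : ℂ)

/-- `f` is a complete Bernstein function on `]0,∞[`: `f(x) = x² g̃(x)` for a Bernstein function
`g`, where `g̃` is the (convergent) Laplace transform of `g`. -/
def IsCompleteBernstein (f : ℝ → ℝ) : Prop :=
  ∃ g : ℝ → ℝ, IsBernstein g ∧ ∀ x : ℝ, 0 < x →
    IntegrableOn (fun t : ℝ => Real.exp (-(x * t)) * g t) (Ioi 0) ∧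
      f x = x ^ 2 * realLaplace g x

/-- `Q(p) = p G̃(p)` for `p > 0`. -/
def realQ (G : ℝ → ℝ) (p : ℝ) : ℝ := p * realLaplace G p

/-- `B(p) = p ρ^(1/2) / Q(p)^(1/2)` for `p > 0`. -/
def realB (ρ : ℝ) (G : ℝ → ℝ) (p : ℝ) : ℝ := p * √ρ / √(realQ G p)

/-- `Q(p) = p G̃(p)` for complex `p`. -/
def Q (G : ℝ → ℝ) (p : ℂ) : ℂ := p * laplace G p

/-- `B(p) = p ρ^(1/2) / Q(p)^(1/2)` for complex `p`, with the principal square root. -/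
def B (ρ : ℝ) (G : ℝ → ℝ) (p : ℂ) : ℂ := p * ((√ρ : ℝ) : ℂ) / (Q G p) ^ (1 / 2 : ℂ)

/-- The wave-front speed `c₀ = √(G₀ / ρ)`; it is infinite when `G₀` is. -/
def frontSpeed (ρ : ℝ) (G₀ : ℝ≥0∞) : ℝ≥0∞ := (G₀ / ENNReal.ofReal ρ) ^ (1 / 2 : ℝ)

/-- The reciprocal `1 / c₀`; it is `0` when `c₀` is infinite. -/
def frontSlowness (ρ : ℝ) (G₀ : ℝ≥0∞) : ℝ := ((frontSpeed ρ G₀)⁻¹).toReal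

/-- `ν` is a positive measure carried by `]0,∞[` with `∫ ν(dr) / (1 + r) < ∞`. -/
def IsSpectralMeasure (ν : Measure ℝ) : Prop :=
  ν (Iic 0) = 0 ∧ ∫⁻ r in Ioi (0 : ℝ), ENNReal.ofReal (1 / (1 + r)) ∂ν < ∞

/-- The dispersion-attenuation function `b(p) = p ∫_{]0,∞[} ν(dr) / (p + r)`. -/
def b (ν : Measure ℝ) (p : ℂ) : ℂ := p * ∫ r in Ioi (0 : ℝ), 1 / (p + (r : ℂ)) ∂ν

/-- The attenuation function `A(p) = Re b(p)`. -/
def attenuation (ν : Measure ℝ) (p : ℂ) : ℝ := (b ν p).re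

/-- The dispersion function `D(p) = -Im b(p)`. -/
def dispersion (ν : Measure ℝ) (p : ℂ) : ℝ := -(b ν p).im

end Viscoelastic

end

open Viscoelastic

/-!
The theorem says that `B(p) / p = √ρ / √Q(p)` is a Stieltjes function
`a + ∫ ν(dr) / (p + r)`, with `a = 1 / c₀`.
The Stieltjes functions are handled in the compactified form `∫ m(du) / (1 - u + u x)` with a finite
measure `m` on `[0,1]`, where `u = 1 / (1 + r)`; the endpoints `u = 0` and `u = 1` carry the
constant and the `1 / x` term. In this form the class is closed under pointwise limits, because
bounded families of measures on `[0,1]` are weakly compact (`exists_measure_integral_eq`). Both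
representation theorems below are obtained as such limits.

* The Laplace transform of a completely monotone `G` is a Stieltjes function
  (`exists_realLaplace_eq_integral_stieltjesKernel`). Taylor's formula at infinity writes `G - G∞`
  as a superposition, with non-negative density, of truncated powers `(s - t)₊ᴺ / N!`, and the
  Laplace transform of such a power agrees with a multiple of the Stieltjes kernel at
  `r = (N + 1) / s` up to the factor `(N + 1) / N`, uniformly in `s`. Hence
  `Q(p) = a p + c + b(p)` extends to the slit plane and preserves the sign of the imaginary part.
* A holomorphic function on the slit plane that is non-negative on `]0,∞[` and reverses the sign of
  the imaginary part is a Stieltjes function (`exists_integral_stieltjesKernel_eq`). The conformal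
  map `((1 + z) / (1 - z))²` turns it into a typically real function `h` on the disc, for which the
  difference of two Cauchy formulas on the circle gives `h(w) - h(0)`, for real `w`, as an integral
  of `Im h · sin θ` against a kernel that is again of Stieltjes form in `u = (1 - cos θ) / 2`; the
  radius is then sent to `1`. Non-negativity at infinity makes `1 / u` integrable against the
  resulting measure, which brings the formula into the required form.

The second theorem applies to `√ρ / √Q`, since the principal root preserves the sign of the
imaginary part. As `B(0+) = 0`, there is no `1 / p` term, and the constant is the limit of
`B(x) / x`, computed by the initial value theorem `Q(x) → G(0+)`. The identity on `]0,∞[` extends to `Re p > 0`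
by analytic continuation. The properties of `b` follow from domination by `1 / (1 + r)`, and `B` is
a complete Bernstein function since `B(x) / x²` is the Laplace transform of
`a + ∫ (1 - exp (-r t)) / r ν(dr)`.
-/

/-! ### Compactness of bounded families of measures -/

/-- Convergence of the integrals of a family of continuous functions against measures of bounded
mass on a compact space suffices to represent the limits by one measure: any limit along an
ultrafilter of the measures does. -/
theorem exists_measure_integral_eq {E ι : Type*} [MeasurableSpace E] [TopologicalSpace E]
    [T2Space E] [BorelSpace E] [CompactSpace E] (k : ι → C(E, ℝ)) (m : ℕ → Measure E)
    (C : NNReal) (hm : ∀ n, m n univ ≤ C) (F : ι → ℝ)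
    (hF : ∀ i, Tendsto (fun n => ∫ e, k i e ∂m n) atTop (𝓝 (F i))) :
    ∃ μ : Measure E, IsFiniteMeasure μ ∧ ∀ i, ∫ e, k i e ∂μ = F i := by
  have hfin : ∀ n, IsFiniteMeasure (m n) := fun n => ⟨(hm n).trans_lt ENNReal.coe_lt_top⟩
  let m' : ℕ → FiniteMeasure E := fun n => Subtype.mk (m n) (hfin n)
  have hm' : ∀ n, (m' n).mass ≤ C := fun n => by
    rw [← ENNReal.coe_le_coe, FiniteMeasure.ennreal_mass]
    exact hm n
  have hc := isCompact_setOfPred_finiteMeasure_le_of_compactSpace E C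
  obtain ⟨μ, -, hμ⟩ := hc.ultrafilter_le_nhds' ((hyperfilter ℕ).map m')
    (Ultrafilter.mem_map.2 (Filter.univ_mem' hm'))
  refine ⟨μ, inferInstance, fun i => ?_⟩
  have h1 := (FiniteMeasure.tendsto_iff_forall_integral_tendsto.1 (show Tendsto m'
    (hyperfilter ℕ) (𝓝 μ) from hμ)) (BoundedContinuousFunction.mkOfCompact (k i))
  exact tendsto_nhds_unique h1 ((hF i).mono_left Nat.hyperfilter_le_atTop)

/-! ### Completely monotone functions -/

namespace Viscoelastic.IsCompletelyMonotone

variable {G : ℝ → ℝ} (hG : IsCompletelyMonotone G)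
include hG

theorem hasDerivAt_iteratedDeriv (n : ℕ) {t : ℝ} (ht : 0 < t) :
    HasDerivAt (iteratedDeriv n G) (iteratedDeriv (n + 1) G t) t := by
  have h1 : DifferentiableOn ℝ (iteratedDerivWithin n G (Ioi 0)) (Ioi 0) :=
    hG.1.differentiableOn_iteratedDerivWithin
      (by exact_mod_cast WithTop.coe_lt_coe.2 (ENat.natCast_lt_top n)) (uniqueDiffOn_Ioi 0)
  have h2 : DifferentiableAt ℝ (iteratedDeriv n G) t :=
    ((h1.congr fun x hx => (iteratedDerivWithin_of_isOpen isOpen_Ioi hx).symm).differentiableAt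
      (Ioi_mem_nhds ht))
  rw [iteratedDeriv_succ]
  exact h2.hasDerivAt

/-- The functions `φₙ = (-1)ⁿ G⁽ⁿ⁾` are non-negative and satisfy `φₙ' = -φₙ₊₁`. -/
theorem hasDerivAt_signed (n : ℕ) {t : ℝ} (ht : 0 < t) :
    HasDerivAt (fun s => (-1) ^ n * iteratedDeriv n G s)
      (-((-1) ^ (n + 1) * iteratedDeriv (n + 1) G t)) t := by
  have h := (hG.hasDerivAt_iteratedDeriv n ht).const_mul ((-1 : ℝ) ^ n)
  rwa [show (-1 : ℝ) ^ n * iteratedDeriv (n + 1) G t =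
    -((-1) ^ (n + 1) * iteratedDeriv (n + 1) G t) by rw [pow_succ]; ring] at h

theorem antitoneOn_signed (n : ℕ) :
    AntitoneOn (fun s => (-1) ^ n * iteratedDeriv n G s) (Ioi 0) := by
  refine antitoneOn_of_deriv_nonpos (convex_Ioi 0)
    (fun t ht => (hG.hasDerivAt_signed n ht).continuousAt.continuousWithinAt) ?_ ?_
  · intro t ht
    rw [interior_Ioi] at ht
    exact (hG.hasDerivAt_signed n ht).differentiableAt.differentiableWithinAt
  · intro t ht
    rw [interior_Ioi] at ht
    rw [(hG.hasDerivAt_signed n ht).deriv]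
    exact neg_nonpos.2 (hG.2 (n + 1) t ht)

theorem antitoneOn : AntitoneOn G (Ioi 0) := by simpa using hG.antitoneOn_signed 0

theorem nonneg {t : ℝ} (ht : 0 < t) : 0 ≤ G t := by simpa using hG.2 0 t ht

theorem continuousOn : ContinuousOn G (Ioi 0) := hG.1.continuousOn

theorem le_of_tendsto {L : ℝ} (hL : Tendsto G atTop (𝓝 L)) {t : ℝ} (ht : 0 < t) : L ≤ G t := by
  refine _root_.le_of_tendsto hL ?_
  filter_upwards [eventually_ge_atTop t] with s hs
  exact hG.antitoneOn ht (ht.trans_le hs) hs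

/-- The mean value theorem bounds `φₙ₊₁(t)` by the decrease of `φₙ` over `[t - 1, t]`. -/
theorem tendsto_signed_succ (n : ℕ) {L : ℝ}
    (hL : Tendsto (fun s => (-1) ^ n * iteratedDeriv n G s) atTop (𝓝 L)) :
    Tendsto (fun s => (-1) ^ (n + 1) * iteratedDeriv (n + 1) G s) atTop (𝓝 0) := by
  have h1 : Tendsto (fun s : ℝ => (-1) ^ n * iteratedDeriv n G (s - 1)
      - (-1) ^ n * iteratedDeriv n G s) atTop (𝓝 0) := by
    simpa [sub_eq_add_neg] using
      (hL.comp (tendsto_atTop_add_const_right atTop (-1 : ℝ) tendsto_id)).sub hL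
  refine tendsto_of_tendsto_of_tendsto_of_le_of_le' tendsto_const_nhds h1 ?_ ?_
  · filter_upwards [eventually_gt_atTop 0] with s hs using hG.2 _ s hs
  · filter_upwards [eventually_gt_atTop 1] with s hs
    obtain ⟨c, hc, h⟩ := exists_hasDerivAt_eq_slope
      (fun s => (-1) ^ n * iteratedDeriv n G s)
      (fun t => -((-1) ^ (n + 1) * iteratedDeriv (n + 1) G t)) (show s - 1 < s by linarith)
      (fun t ht => (hG.hasDerivAt_signed n
        (by linarith [ht.1])).continuousAt.continuousWithinAt)
      (fun t ht => hG.hasDerivAt_signed n (by linarith [ht.1]))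
    have h3 := hG.antitoneOn_signed (n + 1) (show c ∈ Ioi 0 from by
      simp only [mem_Ioi]; linarith [hc.1]) (show s ∈ Ioi 0 from by
      simp only [mem_Ioi]; linarith) hc.2.le
    simp only [sub_sub_cancel, div_one] at h h3
    linarith

theorem tendsto_signed {L : ℝ} (hL : Tendsto G atTop (𝓝 L)) (n : ℕ) :
    Tendsto (fun s => (-1) ^ n * iteratedDeriv n G s) atTop (𝓝 (if n = 0 then L else 0)) := by
  induction n with
  | zero => simpa using hL
  | succ n ih => simpa using hG.tendsto_signed_succ n ih

theorem lintegral_signed_succ {L : ℝ} (hL : Tendsto G atTop (𝓝 L)) (n : ℕ) {t : ℝ} (ht : 0 < t) :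
    ∫⁻ s in Ioi t, ENNReal.ofReal ((-1) ^ (n + 1) * iteratedDeriv (n + 1) G s) =
      ENNReal.ofReal ((-1) ^ n * iteratedDeriv n G t - if n = 0 then L else 0) := by
  have hd : ∀ s ∈ Ici t, HasDerivAt (fun s => (-1) ^ n * iteratedDeriv n G s)
      (-((-1) ^ (n + 1) * iteratedDeriv (n + 1) G s)) s :=
    fun s hs => hG.hasDerivAt_signed n (ht.trans_le hs)
  have hn : ∀ s ∈ Ioi t, -((-1) ^ (n + 1) * iteratedDeriv (n + 1) G s) ≤ 0 :=
    fun s hs => neg_nonpos.2 (hG.2 _ s (ht.trans hs))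
  have h1 := integral_Ioi_of_hasDerivAt_of_nonpos' hd hn (hG.tendsto_signed hL n)
  have h2 := (integrableOn_Ioi_deriv_of_nonpos' hd hn (hG.tendsto_signed hL n)).neg
  simp only [Pi.neg_def, neg_neg] at h2
  rw [integral_neg] at h1
  rw [← ofReal_integral_eq_lintegral_ofReal h2
    ((ae_restrict_mem measurableSet_Ioi).mono fun s hs => hG.2 _ s (ht.trans hs))]
  congr 1
  linarith

end Viscoelastic.IsCompletelyMonotone

/-! ### Taylor's formula at infinity and its Laplace transform -/

/-- Tonelli's theorem on the region `a < s < u`. -/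
theorem lintegral_Ioi_Ioi_swap (h : ℝ → ℝ → ℝ≥0∞) (hh : Measurable (Function.uncurry h)) (a : ℝ) :
    ∫⁻ s in Ioi a, ∫⁻ u in Ioi s, h s u = ∫⁻ u in Ioi a, ∫⁻ s in Ioo a u, h s u := by
  have hS : MeasurableSet {q : ℝ × ℝ | a < q.1 ∧ q.1 < q.2} :=
    (measurableSet_lt measurable_const measurable_fst).inter
      (measurableSet_lt measurable_fst measurable_snd)
  have h1 : ∀ s, (Ioi a).indicator (fun s => ∫⁻ u in Ioi s, h s u) s =
      ∫⁻ u, {q : ℝ × ℝ | a < q.1 ∧ q.1 < q.2}.indicator (Function.uncurry h) (s, u) := by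
    intro s
    by_cases hs : a < s
    · rw [indicator_of_mem (show s ∈ Ioi a from hs), ← lintegral_indicator measurableSet_Ioi]
      congr with u
      by_cases hu : s < u <;> simp [indicator, hs, hu]
    · simp [indicator, hs]
  have h2 : ∀ u, (Ioi a).indicator (fun u => ∫⁻ s in Ioo a u, h s u) u =
      ∫⁻ s, {q : ℝ × ℝ | a < q.1 ∧ q.1 < q.2}.indicator (Function.uncurry h) (s, u) := by
    intro u
    have h3 : ∀ s, {q : ℝ × ℝ | a < q.1 ∧ q.1 < q.2}.indicator (Function.uncurry h) (s, u) =
        (Ioo a u).indicator (fun s => h s u) s := by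
      intro s; simp [indicator]
    simp_rw [h3]
    rw [lintegral_indicator measurableSet_Ioo]
    by_cases hu : a < u
    · simp [indicator, hu]
    · simp [indicator, hu]
  rw [← lintegral_indicator measurableSet_Ioi, ← lintegral_indicator measurableSet_Ioi]
  simp_rw [h1, h2]
  exact lintegral_lintegral_swap (f := fun s u =>
    {q : ℝ × ℝ | a < q.1 ∧ q.1 < q.2}.indicator (Function.uncurry h) (s, u))
    (hh.indicator hS).aemeasurable

theorem lintegral_Ioo_ofReal_eq {f : ℝ → ℝ} (hf : Continuous f) {a b : ℝ} (hab : a ≤ b)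
    (h0 : ∀ s ∈ Ioo a b, 0 ≤ f s) :
    ∫⁻ s in Ioo a b, ENNReal.ofReal (f s) = ENNReal.ofReal (∫ s in a..b, f s) := by
  rw [intervalIntegral.integral_of_le hab, integral_Ioc_eq_integral_Ioo,
    ofReal_integral_eq_lintegral_ofReal]
  · exact (hf.integrableOn_Icc (a := a) (b := b)).mono_set Ioo_subset_Icc_self
  · exact (ae_restrict_mem measurableSet_Ioo).mono h0

theorem measurable_iteratedDeriv_succ (G : ℝ → ℝ) (n : ℕ) :
    Measurable (iteratedDeriv (n + 1) G) := by
  rw [iteratedDeriv_succ]; exact measurable_deriv _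

theorem integral_sub_pow_div_factorial (m : ℕ) (t u : ℝ) :
    ∫ s in t..u, (s - t) ^ m / (m.factorial : ℝ) = (u - t) ^ (m + 1) / ((m + 1).factorial : ℝ) := by
  rw [intervalIntegral.integral_div, intervalIntegral.integral_comp_sub_right (fun s => s ^ m),
    integral_pow, Nat.factorial_succ]
  push_cast
  simp
  field_simp

/-- Taylor's formula with integral remainder, expanded at infinity. -/
theorem Viscoelastic.IsCompletelyMonotone.taylor_atTop {G : ℝ → ℝ} (hG : IsCompletelyMonotone G)
    {L : ℝ} (hL : Tendsto G atTop (𝓝 L)) (m : ℕ) {t : ℝ} (ht : 0 < t) :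
    ENNReal.ofReal (G t - L) = ∫⁻ s in Ioi t,
      ENNReal.ofReal ((-1) ^ (m + 1) * iteratedDeriv (m + 1) G s) *
        ENNReal.ofReal ((s - t) ^ m / (m.factorial : ℝ)) := by
  induction m with
  | zero => simpa using (hG.lintegral_signed_succ hL 0 ht).symm
  | succ m ih =>
    have hmeas := measurable_iteratedDeriv_succ G (m + 1)
    have h1 : ∀ s ∈ Ioi t, ENNReal.ofReal ((-1) ^ (m + 1) * iteratedDeriv (m + 1) G s) *
        ENNReal.ofReal ((s - t) ^ m / (m.factorial : ℝ)) = ∫⁻ u in Ioi s,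
        ENNReal.ofReal ((-1) ^ (m + 2) * iteratedDeriv (m + 2) G u) *
          ENNReal.ofReal ((s - t) ^ m / (m.factorial : ℝ)) := by
      intro s hs
      have h2 := hG.lintegral_signed_succ hL (m + 1) (ht.trans hs)
      simp only [Nat.add_eq_zero_iff, one_ne_zero, and_false, if_false, sub_zero] at h2
      rw [lintegral_mul_const _ (by fun_prop), h2]
    rw [ih, setLIntegral_congr_fun measurableSet_Ioi h1, lintegral_Ioi_Ioi_swap _ (by
      unfold Function.uncurry; fun_prop)]
    refine setLIntegral_congr_fun measurableSet_Ioi fun u hu => ?_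
    have hu' : t < u := hu
    rw [lintegral_const_mul _ (by fun_prop), lintegral_Ioo_ofReal_eq (by fun_prop) hu'.le
      (fun s hs => by have := sub_pos.2 hs.1; positivity), integral_sub_pow_div_factorial]

/-- The Laplace transform in `t` of the Taylor kernel `(s - t)₊ᴺ / N!`. -/
noncomputable def taylorLaplace (N : ℕ) (x s : ℝ) : ℝ :=
  ∫ t in (0 : ℝ)..s, Real.exp (-(x * t)) * ((s - t) ^ N / (N.factorial : ℝ))

/-- Integration by parts. Together with `taylorLaplace_succ_le`, it gives the two-sided
bound on `taylorLaplace`. -/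
theorem taylorLaplace_recurrence (N : ℕ) (x s : ℝ) :
    x * taylorLaplace (N + 1) x s + taylorLaplace N x s =
      s ^ (N + 1) / ((N + 1).factorial : ℝ) := by
  have hd : ∀ t ∈ uIcc 0 s, HasDerivAt
      (fun t => -(Real.exp (-(x * t)) * ((s - t) ^ (N + 1) / ((N + 1).factorial : ℝ))))
      (x * (Real.exp (-(x * t)) * ((s - t) ^ (N + 1) / ((N + 1).factorial : ℝ))) +
        Real.exp (-(x * t)) * ((s - t) ^ N / (N.factorial : ℝ))) t := by
    intro t _
    have h1 : HasDerivAt (fun t => Real.exp (-(x * t))) (Real.exp (-(x * t)) * (-(x * 1))) t :=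
      (((hasDerivAt_id t).const_mul x).neg).exp
    have h2 : HasDerivAt (fun t => (s - t) ^ (N + 1) / ((N + 1).factorial : ℝ))
        ((N + 1 : ℕ) * (s - t) ^ N * (-1) / ((N + 1).factorial : ℝ)) t :=
      ((((hasDerivAt_id t).const_sub s).pow (N + 1)).div_const ((N + 1).factorial : ℝ))
    refine (h1.mul h2).neg.congr_deriv ?_
    have : (N.factorial : ℝ) ≠ 0 := by positivity
    simp only [Nat.factorial_succ]
    push_cast
    have : (N + 1 : ℝ) ≠ 0 := by positivity
    field_simp
    ring
  have h := intervalIntegral.integral_eq_sub_of_hasDerivAt hd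
    (Continuous.intervalIntegrable (by fun_prop) _ _)
  rw [intervalIntegral.integral_add (Continuous.intervalIntegrable (by fun_prop) _ _)
    (Continuous.intervalIntegrable (by fun_prop) _ _), intervalIntegral.integral_const_mul] at h
  simpa [taylorLaplace] using h

theorem taylorLaplace_succ_le (N : ℕ) (x : ℝ) {s : ℝ} (hs : 0 ≤ s) :
    (N + 1) * taylorLaplace (N + 1) x s ≤ s * taylorLaplace N x s := by
  rw [taylorLaplace, taylorLaplace, ← intervalIntegral.integral_const_mul,
    ← intervalIntegral.integral_const_mul]
  refine intervalIntegral.integral_mono_on hs (Continuous.intervalIntegrable (by fun_prop) _ _)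
    (Continuous.intervalIntegrable (by fun_prop) _ _) fun t ht => ?_
  have h1 : 0 ≤ s - t := sub_nonneg.2 ht.2
  have hN : (N.factorial : ℝ) ≠ 0 := by positivity
  have hN1 : (N + 1 : ℝ) ≠ 0 := by positivity
  have h2 : (N + 1 : ℝ) * (Real.exp (-(x * t)) * ((s - t) ^ (N + 1) / ((N + 1).factorial : ℝ))) =
      (s - t) * (Real.exp (-(x * t)) * ((s - t) ^ N / (N.factorial : ℝ))) := by
    rw [Nat.factorial_succ]; push_cast; field_simp; ring
  rw [h2]
  exact mul_le_mul_of_nonneg_right (by linarith [ht.1]) (by positivity)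

/-- Lower bound comparing the transformed Taylor kernel with the Stieltjes kernel at
`r = (N + 1) / s`. -/
theorem le_taylorLaplace (N : ℕ) {x s : ℝ} (hx : 0 < x) (hs : 0 < s) :
    s ^ N / (N.factorial : ℝ) * (s / (x * s + N + 1)) ≤ taylorLaplace N x s := by
  have h1 := taylorLaplace_recurrence N x s
  have h2 := taylorLaplace_succ_le N x hs.le
  have hN : (0 : ℝ) < N + 1 := by positivity
  have h3 : s ^ (N + 1) / (((N + 1).factorial : ℕ) : ℝ) * (N + 1) =
      s ^ N / (N.factorial : ℝ) * s := by
    rw [Nat.factorial_succ]; push_cast; field_simp; ring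
  rw [← mul_div_assoc, div_le_iff₀ (by positivity), ← h3, ← h1]
  nlinarith [mul_le_mul_of_nonneg_left h2 hx.le]

/-- Upper bound matching `le_taylorLaplace` up to the factor `(n + 2) / (n + 1)`, uniformly in
`s`. -/
theorem taylorLaplace_le (n : ℕ) {x s : ℝ} (hx : 0 < x) (hs : 0 < s) :
    taylorLaplace (n + 1) x s ≤ (n + 2 : ℝ) / (n + 1) *
      (s ^ (n + 1) / ((n + 1).factorial : ℝ) * (s / (x * s + (n + 1 : ℕ) + 1))) := by
  have h1 := taylorLaplace_recurrence n x s
  have h2 := taylorLaplace_succ_le n x hs.le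
  set A := s ^ (n + 1) / ((n + 1).factorial : ℝ) with hA
  have hA0 : 0 ≤ A := by positivity
  have hn : (0 : ℝ) < n + 1 := by positivity
  have h3 : taylorLaplace (n + 1) x s * (x * s + n + 1) ≤ A * s := by rw [← h1]; linarith
  rw [← le_div_iff₀ (by positivity)] at h3
  refine h3.trans ?_
  clear_value A
  push_cast
  rw [show (n + 2 : ℝ) / (n + 1) * (A * (s / (x * s + (n + 1) + 1))) =
    A * s * (n + 2) / ((n + 1) * (x * s + (n + 1) + 1)) by field_simp,
    div_le_div_iff₀ (by positivity) (by positivity)]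
  have : 0 ≤ A * s * (x * s) := by positivity
  nlinarith

theorem Viscoelastic.IsCompletelyMonotone.lintegral_exp_mul_eq {G : ℝ → ℝ}
    (hG : IsCompletelyMonotone G) {L : ℝ} (hL : Tendsto G atTop (𝓝 L)) (N : ℕ) (x : ℝ) :
    ∫⁻ t in Ioi 0, ENNReal.ofReal (Real.exp (-(x * t)) * (G t - L)) =
      ∫⁻ s in Ioi 0, ENNReal.ofReal ((-1) ^ (N + 1) * iteratedDeriv (N + 1) G s) *
        ENNReal.ofReal (taylorLaplace N x s) := by
  have hmeas := measurable_iteratedDeriv_succ G N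
  have h1 : ∀ t ∈ Ioi (0 : ℝ), ENNReal.ofReal (Real.exp (-(x * t)) * (G t - L)) =
      ∫⁻ s in Ioi t, ENNReal.ofReal ((-1) ^ (N + 1) * iteratedDeriv (N + 1) G s) *
        (ENNReal.ofReal (Real.exp (-(x * t)) * ((s - t) ^ N / (N.factorial : ℝ)))) := by
    intro t ht
    rw [ENNReal.ofReal_mul (Real.exp_pos _).le, hG.taylor_atTop hL N ht,
      ← lintegral_const_mul _ (by fun_prop)]
    congr with s
    rw [ENNReal.ofReal_mul (Real.exp_pos _).le]
    ring
  rw [setLIntegral_congr_fun measurableSet_Ioi h1, lintegral_Ioi_Ioi_swap _ (by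
      unfold Function.uncurry; fun_prop)]
  refine setLIntegral_congr_fun measurableSet_Ioi fun s hs => ?_
  have hs' : (0 : ℝ) < s := hs
  rw [lintegral_const_mul _ (by fun_prop), lintegral_Ioo_ofReal_eq (by fun_prop) hs'.le
    (fun t ht => by have := sub_pos.2 ht.2; positivity), taylorLaplace]

/-! ### The Laplace transform of a completely monotone function -/

theorem stieltjesKernel_denom_pos (u : unitInterval) {x : ℝ} (hx : 0 < x) :
    0 < 1 - (u : ℝ) + u * x := by
  have h1 := u.2.1
  have h2 := u.2.2
  rcases h1.eq_or_lt with h | h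
  · rw [← h]; norm_num
  · have := mul_pos h hx; linarith

/-- The kernel `1 / (1 - u + u x)` on `[0,1]`; it is the Stieltjes kernel `(1 + r) / (x + r)`
after the substitution `u = 1 / (1 + r)`, which compactifies `[0,∞]`. -/
noncomputable def stieltjesKernel (x : Ioi (0 : ℝ)) : C(unitInterval, ℝ) where
  toFun u := (1 - (u : ℝ) + u * (x : ℝ))⁻¹
  continuous_toFun := by
    exact Continuous.inv₀ (by fun_prop) fun u => (stieltjesKernel_denom_pos u x.2).ne'

namespace Viscoelastic.IsCompletelyMonotone

variable {G : ℝ → ℝ} (hG : IsCompletelyMonotone G)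
include hG

theorem integrableOn_exp_mul (hint : IntegrableOn G (Ioc 0 1)) {x : ℝ} (hx : 0 < x) :
    IntegrableOn (fun t => Real.exp (-(x * t)) * G t) (Ioi 0) := by
  have hm : ∀ {s : Set ℝ}, s ⊆ Ioi 0 → MeasurableSet s →
      AEStronglyMeasurable (fun t => Real.exp (-(x * t)) * G t) (volume.restrict s) :=
    fun hs hsm => (ContinuousOn.mul (by fun_prop)
      (hG.continuousOn.mono hs)).aestronglyMeasurable hsm
  rw [← Ioc_union_Ioi_eq_Ioi zero_le_one]
  refine IntegrableOn.union ?_ ?_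
  · refine Integrable.mono' hint (hm Ioc_subset_Ioi_self measurableSet_Ioc) ?_
    filter_upwards [ae_restrict_mem measurableSet_Ioc] with t ht
    rw [Real.norm_of_nonneg (mul_nonneg (Real.exp_pos _).le (hG.nonneg ht.1))]
    refine mul_le_of_le_one_left (hG.nonneg ht.1) (Real.exp_le_one_iff.2 ?_)
    have := mul_pos hx ht.1
    linarith
  · have h1 : IntegrableOn (fun t => Real.exp (-x * t) * G 1) (Ioi 1) :=
      (integrableOn_exp_mul_Ioi (neg_neg_of_pos hx) 1).mul_const _
    refine Integrable.mono' h1 (hm (Ioi_subset_Ioi zero_le_one) measurableSet_Ioi) ?_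
    filter_upwards [ae_restrict_mem measurableSet_Ioi] with t ht
    have ht0 : (0 : ℝ) < t := zero_lt_one.trans ht
    rw [Real.norm_of_nonneg (mul_nonneg (Real.exp_pos _).le (hG.nonneg ht0)), neg_mul]
    exact mul_le_mul_of_nonneg_left (hG.antitoneOn (mem_Ioi.2 one_pos) ht0 (le_of_lt ht))
      (Real.exp_pos _).le

end Viscoelastic.IsCompletelyMonotone

theorem integrableOn_exp_neg_mul {x : ℝ} (hx : 0 < x) (c : ℝ) :
    IntegrableOn (fun t => Real.exp (-(x * t)) * c) (Ioi 0) := by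
  simp only [← neg_mul]
  exact (integrableOn_exp_mul_Ioi (neg_neg_of_pos hx) 0).mul_const c

theorem integral_exp_neg_mul {x : ℝ} (hx : 0 < x) :
    ∫ t in Ioi (0 : ℝ), Real.exp (-(x * t)) = 1 / x := by
  have := integral_exp_mul_Ioi (neg_neg_of_pos hx) 0
  simp only [neg_mul, mul_zero, Real.exp_zero] at this
  rw [this]; simp

/-- The position on `[0,1]` of the atom `r = (N + 1) / s`. -/
noncomputable def taylorPoint (N : ℕ) (s : ℝ) : unitInterval :=
  projIcc 0 1 zero_le_one (s / (s + N + 1))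

theorem measurable_taylorPoint (N : ℕ) : Measurable (taylorPoint N) :=
  continuous_projIcc.measurable.comp (by fun_prop)

theorem coe_taylorPoint (N : ℕ) {s : ℝ} (hs : 0 < s) :
    (taylorPoint N s : ℝ) = s / (s + N + 1) := by
  rw [taylorPoint, projIcc_of_mem]
  exact ⟨by positivity, (div_le_one (by positivity)).2 (by linarith [N.cast_nonneg (α := ℝ)])⟩

/-- The `N`-th approximation of the spectral measure of `G`: the density in Taylor's formula at
infinity, transported to `[0,1]`. -/
noncomputable def taylorMeasure (G : ℝ → ℝ) (N : ℕ) : Measure unitInterval :=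
  ((volume.restrict (Ioi 0)).withDensity fun s =>
    ENNReal.ofReal ((-1) ^ (N + 1) * iteratedDeriv (N + 1) G s) *
      ENNReal.ofReal (s ^ N / (N.factorial : ℝ) * (s / (s + N + 1)))).map (taylorPoint N)

theorem lintegral_taylorMeasure (G : ℝ → ℝ) (N : ℕ) (x : Ioi (0 : ℝ)) :
    ∫⁻ u, ENNReal.ofReal (stieltjesKernel x u) ∂taylorMeasure G N =
      ∫⁻ s in Ioi 0, ENNReal.ofReal ((-1) ^ (N + 1) * iteratedDeriv (N + 1) G s) *
        ENNReal.ofReal (s ^ N / (N.factorial : ℝ) * (s / (x * s + N + 1))) := by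
  have hmeas := measurable_iteratedDeriv_succ G N
  have hk : Measurable fun u => ENNReal.ofReal (stieltjesKernel x u) :=
    (stieltjesKernel x).continuous.measurable.ennreal_ofReal
  rw [taylorMeasure, lintegral_map hk (measurable_taylorPoint N),
    lintegral_withDensity_eq_lintegral_mul _ (by fun_prop)
      (show Measurable fun s => ENNReal.ofReal (stieltjesKernel x (taylorPoint N s)) from
        hk.comp (measurable_taylorPoint N))]
  refine setLIntegral_congr_fun measurableSet_Ioi fun s hs => ?_
  have hs' : (0 : ℝ) < s := hs
  have hx : (0 : ℝ) < x := x.2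
  simp only [Pi.mul_apply]
  rw [mul_assoc, ← ENNReal.ofReal_mul (by positivity)]
  congr 2
  simp only [stieltjesKernel, ContinuousMap.coe_mk, coe_taylorPoint N hs']
  have h1 : s + N + 1 ≠ 0 := by positivity
  have h2 : (x : ℝ) * s + N + 1 ≠ 0 := by positivity
  have h3 : 1 - s / (s + N + 1) + s / (s + N + 1) * x = (x * s + N + 1) / (s + N + 1) := by
    field_simp; ring
  rw [h3, inv_div]
  field_simp

theorem lintegral_taylorMeasure_le {G : ℝ → ℝ} (hG : IsCompletelyMonotone G) {L : ℝ}
    (hL : Tendsto G atTop (𝓝 L)) (N : ℕ) (x : Ioi (0 : ℝ)) :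
    ∫⁻ u, ENNReal.ofReal (stieltjesKernel x u) ∂taylorMeasure G N ≤
      ∫⁻ t in Ioi 0, ENNReal.ofReal (Real.exp (-(x * t)) * (G t - L)) := by
  rw [lintegral_taylorMeasure, hG.lintegral_exp_mul_eq hL N]
  refine setLIntegral_mono' measurableSet_Ioi fun s hs => ?_
  gcongr
  exact le_taylorLaplace N x.2 hs

theorem le_lintegral_taylorMeasure {G : ℝ → ℝ} (hG : IsCompletelyMonotone G) {L : ℝ}
    (hL : Tendsto G atTop (𝓝 L)) (n : ℕ) (x : Ioi (0 : ℝ)) :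
    ∫⁻ t in Ioi 0, ENNReal.ofReal (Real.exp (-(x * t)) * (G t - L)) ≤
      ENNReal.ofReal ((n + 2) / (n + 1)) *
        ∫⁻ u, ENNReal.ofReal (stieltjesKernel x u) ∂taylorMeasure G (n + 1) := by
  have hmeas := measurable_iteratedDeriv_succ G (n + 1)
  rw [lintegral_taylorMeasure, hG.lintegral_exp_mul_eq hL (n + 1),
    ← lintegral_const_mul' _ _ ENNReal.ofReal_ne_top]
  refine setLIntegral_mono' measurableSet_Ioi fun s hs => ?_
  rw [mul_left_comm, ← ENNReal.ofReal_mul (p := ((n : ℝ) + 2) / (n + 1)) (by positivity)]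
  gcongr
  exact taylorLaplace_le n x.2 hs

/-- The Laplace transform of a completely monotone function is a Stieltjes function. -/
theorem exists_realLaplace_eq_integral_stieltjesKernel {G : ℝ → ℝ} (hG : IsCompletelyMonotone G)
    (hint : IntegrableOn G (Ioc 0 1)) {L : ℝ} (hL : Tendsto G atTop (𝓝 L)) :
    ∃ μ : Measure unitInterval, IsFiniteMeasure μ ∧ ∀ x : Ioi (0 : ℝ),
      ∫ u, stieltjesKernel x u ∂μ = realLaplace G x := by
  have hL0 : 0 ≤ L := ge_of_tendsto hL (by
    filter_upwards [eventually_gt_atTop 0] with t ht using hG.nonneg ht)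
  set F : Ioi (0 : ℝ) → ℝ := fun x => ∫ t in Ioi 0, Real.exp (-(x * t)) * (G t - L) with hF
  have hFint : ∀ x : Ioi (0 : ℝ),
      IntegrableOn (fun t => Real.exp (-(x * t)) * (G t - L)) (Ioi 0) := fun x => by
    simp only [mul_sub]
    exact (hG.integrableOn_exp_mul hint x.2).sub (integrableOn_exp_neg_mul x.2 L)
  have hFnn : ∀ x : Ioi (0 : ℝ), ∀ᵐ t ∂volume.restrict (Ioi 0),
      0 ≤ Real.exp (-(x * t)) * (G t - L) := fun x =>
    (ae_restrict_mem measurableSet_Ioi).mono fun t ht =>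
      mul_nonneg (Real.exp_pos _).le (sub_nonneg.2 (hG.le_of_tendsto hL ht))
  have hFeq : ∀ x : Ioi (0 : ℝ), ∫⁻ t in Ioi 0, ENNReal.ofReal (Real.exp (-(x * t)) * (G t - L)) =
      ENNReal.ofReal (F x) := fun x => (ofReal_integral_eq_lintegral_ofReal (hFint x) (hFnn x)).symm
  have hF0 : ∀ x, 0 ≤ F x := fun x => integral_nonneg_of_ae (hFnn x)
  have hkpos : ∀ (x : Ioi (0 : ℝ)) u, 0 ≤ stieltjesKernel x u := fun x u =>
    (inv_pos.2 (stieltjesKernel_denom_pos u x.2)).le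
  have hmass : ∀ N, taylorMeasure G N univ ≤ ENNReal.ofReal (F ⟨1, mem_Ioi.2 one_pos⟩) :=
      fun N => by
    have h := lintegral_taylorMeasure_le hG hL N ⟨1, mem_Ioi.2 one_pos⟩
    rw [hFeq] at h
    refine le_trans (le_of_eq ?_) h
    simp [stieltjesKernel]
  have hint' : ∀ N x, ∫ u, stieltjesKernel x u ∂taylorMeasure G N =
      (∫⁻ u, ENNReal.ofReal (stieltjesKernel x u) ∂taylorMeasure G N).toReal := fun N x =>
    integral_eq_lintegral_of_nonneg_ae (Eventually.of_forall (hkpos x))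
      (stieltjesKernel x).continuous.aestronglyMeasurable
  have hle : ∀ N x, ∫ u, stieltjesKernel x u ∂taylorMeasure G N ≤ F x := fun N x => by
    rw [hint']
    refine ENNReal.toReal_le_of_le_ofReal (hF0 x) ?_
    rw [← hFeq]
    exact lintegral_taylorMeasure_le hG hL N x
  have hge : ∀ (n : ℕ) x, (n + 1 : ℝ) / (n + 2) * F x ≤
      ∫ u, stieltjesKernel x u ∂taylorMeasure G (n + 1) := fun n x => by
    have h := le_lintegral_taylorMeasure hG hL n x
    have htop : ∫⁻ u, ENNReal.ofReal (stieltjesKernel x u) ∂taylorMeasure G (n + 1) ≠ ∞ :=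
      ((lintegral_taylorMeasure_le hG hL (n + 1) x).trans_lt
        (by rw [hFeq]; exact ENNReal.ofReal_lt_top)).ne
    rw [hFeq, ← ENNReal.ofReal_toReal htop, ← hint', ← ENNReal.ofReal_mul (by positivity),
      ENNReal.ofReal_le_ofReal_iff (mul_nonneg (by positivity)
        (integral_nonneg (hkpos x)))] at h
    rw [div_mul_eq_mul_div, div_le_iff₀ (by positivity)]
    rw [div_mul_eq_mul_div, le_div_iff₀ (by positivity)] at h
    linarith
  obtain ⟨μ, hμfin, hμ⟩ := exists_measure_integral_eq stieltjesKernel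
    (fun n => taylorMeasure G (n + 1)) (F ⟨1, mem_Ioi.2 one_pos⟩).toNNReal
    (fun n => hmass (n + 1)) F (fun x => by
      have h1 : Tendsto (fun n : ℕ => (n + 1 : ℝ) / (n + 2) * F x) atTop (𝓝 (1 * F x)) := by
        refine Tendsto.mul_const _ ?_
        have := (tendsto_natCast_div_add_atTop (1 : ℝ)).comp (tendsto_add_atTop_nat 1)
        refine this.congr fun n => ?_
        simp only [Function.comp]; push_cast; ring_nf
      rw [one_mul] at h1
      exact tendsto_of_tendsto_of_tendsto_of_le_of_le h1 tendsto_const_nhds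
        (fun n => hge n x) (fun n => hle (n + 1) x))
  -- the constant `L` contributes the atom `L δ₁`, that is `L / x`
  have hdfin : IsFiniteMeasure (ENNReal.ofReal L • Measure.dirac (1 : unitInterval)) :=
    Measure.smul_finite _ ENNReal.ofReal_ne_top
  refine ⟨μ + ENNReal.ofReal L • Measure.dirac 1, inferInstance, fun x => ?_⟩
  have hki : ∀ (ν : Measure unitInterval) [IsFiniteMeasure ν], Integrable (stieltjesKernel x) ν :=
    fun ν _ => BoundedContinuousFunction.integrable ν
      (BoundedContinuousFunction.mkOfCompact (stieltjesKernel x))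
  rw [integral_add_measure (hki _) (hki _), hμ]
  have h2 : F x = realLaplace G x - L / x := by
    simp only [hF, mul_sub]
    rw [integral_sub (hG.integrableOn_exp_mul hint x.2) (integrableOn_exp_neg_mul x.2 L),
      integral_mul_const, integral_exp_neg_mul x.2, realLaplace]
    ring
  rw [h2]
  simp [stieltjesKernel, hL0]
  ring

/-! ### Spectral measures and the function `b` -/

/-- The point `-r` stays away from `p` at a distance comparable to `1 + r`, so that the integrals
over a spectral measure are dominated by `∫ ν(dr) / (1 + r)`. -/
theorem exists_mul_one_add_le_norm_add {p : ℂ} (hp : p ∈ Complex.slitPlane) :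
    ∃ ε : ℝ, 0 < ε ∧ ∀ r : ℝ, 0 ≤ r → ε * (1 + r) ≤ ‖p + (r : ℂ)‖ := by
  rcases Complex.mem_slitPlane_iff.1 hp with h | h
  · refine ⟨min p.re 1, lt_min h one_pos, fun r hr => ?_⟩
    calc min p.re 1 * (1 + r) ≤ p.re + r := by
          have h1 := min_le_left p.re 1
          have h2 := min_le_right p.re 1
          nlinarith
      _ ≤ |(p + (r : ℂ)).re| := by simpa using le_abs_self (p.re + r)
      _ ≤ _ := Complex.abs_re_le_norm _
  · have him : 0 < |p.im| := abs_pos.2 h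
    refine ⟨|p.im| / (1 + ‖p‖ + |p.im|), by positivity, fun r hr => ?_⟩
    have h1 : |p.im| ≤ ‖p + (r : ℂ)‖ := by simpa using Complex.abs_im_le_norm (p + (r : ℂ))
    have h2 : r ≤ ‖p + (r : ℂ)‖ + ‖p‖ := by
      have := norm_sub_le (p + (r : ℂ)) p
      simpa [abs_of_nonneg hr] using this
    rw [div_mul_eq_mul_div, div_le_iff₀ (by positivity)]
    have h3 := norm_nonneg p
    nlinarith [mul_le_mul_of_nonneg_left h2 him.le, mul_le_mul_of_nonneg_right h1 h3]

theorem continuous_add_ofReal (p : ℂ) : Continuous fun r : ℝ => p + (r : ℂ) := by fun_prop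

theorem measurable_one_div_add (p : ℂ) : Measurable fun r : ℝ => 1 / (p + (r : ℂ)) := by
  simp only [one_div]
  exact (continuous_add_ofReal p).measurable.inv

namespace Viscoelastic.IsSpectralMeasure

variable {ν : Measure ℝ} (hν : IsSpectralMeasure ν)
include hν

theorem integrableOn_one_div_one_add : IntegrableOn (fun r => 1 / (1 + r)) (Ioi 0) ν := by
  refine ⟨Measurable.aestronglyMeasurable (by fun_prop), ?_⟩
  rw [hasFiniteIntegral_iff_ofReal]
  · exact hν.2
  · filter_upwards [ae_restrict_mem measurableSet_Ioi] with r hr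
    have : (0 : ℝ) < r := hr
    simp only [Pi.zero_apply]; positivity

theorem integrableOn_of_norm_le {E : Type*} [NormedAddCommGroup E] {g : ℝ → E}
    (hg : AEStronglyMeasurable g (ν.restrict (Ioi 0))) (C : ℝ)
    (h : ∀ r, 0 < r → ‖g r‖ ≤ C * (1 / (1 + r))) : IntegrableOn g (Ioi 0) ν :=
  (hν.integrableOn_one_div_one_add.const_mul C).mono' hg
    ((ae_restrict_mem measurableSet_Ioi).mono h)

theorem integrableOn_one_div_add {p : ℂ} (hp : p ∈ Complex.slitPlane) :
    IntegrableOn (fun r : ℝ => 1 / (p + (r : ℂ))) (Ioi 0) ν := by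
  obtain ⟨ε, hε, h⟩ := exists_mul_one_add_le_norm_add hp
  refine hν.integrableOn_of_norm_le (measurable_one_div_add p).aestronglyMeasurable ε⁻¹
    fun r hr => ?_
  rw [norm_div, norm_one, ← one_div, div_mul_div_comm, one_mul]
  exact one_div_le_one_div_of_le (by positivity) (h r hr.le)

theorem integrableOn_one_div_add_real {x : ℝ} (hx : 0 < x) :
    IntegrableOn (fun r : ℝ => 1 / (x + r)) (Ioi 0) ν := by
  have := (hν.integrableOn_one_div_add (Complex.ofReal_mem_slitPlane.2 hx)).re
  refine this.congr (Eventually.of_forall fun r => ?_)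
  simp [← Complex.ofReal_add, ← Complex.ofReal_inv]

theorem differentiableAt_integral {p : ℂ} (hp : p ∈ Complex.slitPlane) :
    DifferentiableAt ℂ (fun p => ∫ r in Ioi (0 : ℝ), 1 / (p + (r : ℂ)) ∂ν) p := by
  obtain ⟨ε, hε, h⟩ := exists_mul_one_add_le_norm_add hp
  have hball : ∀ q ∈ Metric.ball p (ε / 2), ∀ r : ℝ, 0 < r →
      ε / 2 * (1 + r) ≤ ‖q + (r : ℂ)‖ := by
    intro q hq r hr
    have h1 : ‖p + (r : ℂ)‖ ≤ ‖q + (r : ℂ)‖ + ‖q - p‖ := by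
      have := norm_sub_le (q + (r : ℂ)) (q - p)
      rwa [show q + (r : ℂ) - (q - p) = p + r by ring] at this
    rw [Metric.mem_ball, dist_eq_norm] at hq
    have h2 := h r hr.le
    nlinarith
  refine (hasDerivAt_integral_of_dominated_loc_of_deriv_le
    (F' := fun q r => -1 / (q + (r : ℂ)) ^ 2) (bound := fun r => (4 / ε ^ 2) * (1 / (1 + r)))
    (Metric.ball_mem_nhds p (half_pos hε))
    (Eventually.of_forall fun q => (measurable_one_div_add q).aestronglyMeasurable)
    (hν.integrableOn_one_div_add hp) ?_ ?_ (hν.integrableOn_one_div_one_add.const_mul _)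
    ?_).2.differentiableAt
  · exact (Measurable.div measurable_const
      ((continuous_add_ofReal p).pow 2).measurable).aestronglyMeasurable
  · filter_upwards [ae_restrict_mem measurableSet_Ioi] with r hr q hq
    have hr' : (0 : ℝ) < r := hr
    have h1 := hball q hq r hr
    rw [norm_div, norm_neg, norm_one, norm_pow, div_mul_div_comm, mul_one]
    rw [div_le_div_iff₀ (by have : 0 < ‖q + (r : ℂ)‖ := lt_of_lt_of_le (by positivity) h1
                            positivity) (by positivity)]
    have h2 : (ε / 2 * (1 + r)) ^ 2 ≤ ‖q + (r : ℂ)‖ ^ 2 := pow_le_pow_left₀ (by positivity) h1 2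
    have h3 : 0 ≤ ε ^ 2 * (1 + r) * r := by positivity
    nlinarith
  · filter_upwards [ae_restrict_mem measurableSet_Ioi] with r hr q hq
    have hr' : (0 : ℝ) < r := hr
    have h0 : q + (r : ℂ) ≠ 0 := norm_pos_iff.1 (lt_of_lt_of_le (by positivity) (hball q hq r hr))
    simp only [one_div]
    exact ((hasDerivAt_id q).add_const (r : ℂ)).inv h0

theorem differentiableOn_b : DifferentiableOn ℂ (b ν) Complex.slitPlane := fun _ hp =>
  (differentiableAt_id.mul (hν.differentiableAt_integral hp)).differentiableWithinAt

theorem tendsto_integral_cobounded :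
    Tendsto (fun p => ∫ r in Ioi (0 : ℝ), 1 / (p + (r : ℂ)) ∂ν)
      (Bornology.cobounded ℂ ⊓ 𝓟 {p : ℂ | 0 ≤ p.re}) (𝓝 0) := by
  have hcg : (Bornology.cobounded ℂ).IsCountablyGenerated := by
    rw [← comap_norm_atTop]; infer_instance
  rw [← integral_zero ℝ ℂ (μ := ν.restrict (Ioi 0))]
  refine tendsto_integral_filter_of_dominated_convergence (fun r => 2 * (1 / (1 + r)))
    (Eventually.of_forall fun q => (measurable_one_div_add q).aestronglyMeasurable) ?_
    (hν.integrableOn_one_div_one_add.const_mul 2) ?_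
  · have h1 : ∀ᶠ p in Bornology.cobounded ℂ, 1 ≤ ‖p‖ :=
      tendsto_norm_cobounded_atTop.eventually_ge_atTop 1
    filter_upwards [h1.filter_mono inf_le_left,
      mem_inf_of_right (mem_principal_self _)] with p hp hre
    filter_upwards [ae_restrict_mem measurableSet_Ioi] with r hr
    have hr' : (0 : ℝ) < r := hr
    have hre' : 0 ≤ p.re := hre
    have h2 : (1 + r) / 2 ≤ ‖p + (r : ℂ)‖ := by
      refine le_of_sq_le_sq ?_ (norm_nonneg _)
      have h3 : ‖p‖ ^ 2 = p.re ^ 2 + p.im ^ 2 := by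
        rw [← Complex.normSq_eq_norm_sq, Complex.normSq_apply]; ring
      have h4 : ‖p + (r : ℂ)‖ ^ 2 = (p.re + r) ^ 2 + p.im ^ 2 := by
        rw [← Complex.normSq_eq_norm_sq, Complex.normSq_apply]; simp; ring
      have h5 : 1 ≤ ‖p‖ ^ 2 := one_le_pow₀ hp
      rw [h4]
      nlinarith [mul_nonneg hre' hr'.le, sq_nonneg (r - 1)]
    rw [norm_div, norm_one, mul_one_div, ← one_div_div (1 + r) 2]
    exact one_div_le_one_div_of_le (by positivity) h2
  · refine Eventually.of_forall fun r => ?_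
    simp only [one_div]
    refine (Filter.tendsto_inv₀_cobounded.comp ?_).mono_left inf_le_left
    exact tendsto_add_const_cobounded (r : ℂ)

theorem isLittleO_b :
    b ν =o[Bornology.cobounded ℂ ⊓ 𝓟 {p : ℂ | 0 ≤ p.re}] fun p : ℂ => p := by
  have := (isBigO_refl (fun p : ℂ => p)
    (Bornology.cobounded ℂ ⊓ 𝓟 {p : ℂ | 0 ≤ p.re})).mul_isLittleO
      ((isLittleO_one_iff ℂ).2 hν.tendsto_integral_cobounded)
  simpa only [mul_one] using! this

end Viscoelastic.IsSpectralMeasure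

theorem b_ofReal (ν : Measure ℝ) (x : ℝ) :
    b ν (x : ℂ) = ((x * ∫ r in Ioi (0 : ℝ), 1 / (x + r) ∂ν : ℝ) : ℂ) := by
  rw [b, Complex.ofReal_mul, ← integral_complex_ofReal]
  congr 1
  exact integral_congr_ae (Eventually.of_forall fun r => by push_cast; rfl)

theorem mem_slitPlane_of_re_nonneg {p : ℂ} (hp : 0 ≤ p.re) (h0 : p ≠ 0) :
    p ∈ Complex.slitPlane := by
  rw [Complex.mem_slitPlane_iff]
  rcases hp.lt_or_eq with h | h
  · exact Or.inl h
  · exact Or.inr fun him => h0 (Complex.ext h.symm him)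

theorem re_div_add_ofReal (p : ℂ) (r : ℝ) :
    (p * (1 / (p + (r : ℂ)))).re = (‖p‖ ^ 2 + r * p.re) / ‖p + (r : ℂ)‖ ^ 2 := by
  rw [← Complex.normSq_eq_norm_sq, ← Complex.normSq_eq_norm_sq, mul_one_div, Complex.div_re,
    ← add_div]
  congr 1
  simp [Complex.normSq_apply]
  ring

theorem im_div_add_ofReal (p : ℂ) (r : ℝ) :
    (p * (1 / (p + (r : ℂ)))).im = p.im * (r / ‖p + (r : ℂ)‖ ^ 2) := by
  rw [← Complex.normSq_eq_norm_sq, mul_one_div, Complex.div_im, ← sub_div, ← mul_div_assoc]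
  congr 1
  simp
  ring

namespace Viscoelastic.IsSpectralMeasure

variable {ν : Measure ℝ} (hν : IsSpectralMeasure ν)
include hν

theorem integrableOn_re {p : ℂ} (hp : p ∈ Complex.slitPlane) :
    IntegrableOn (fun r : ℝ => (‖p‖ ^ 2 + r * p.re) / ‖p + (r : ℂ)‖ ^ 2) (Ioi 0) ν := by
  have := ((hν.integrableOn_one_div_add hp).const_mul p).re
  exact this.congr (Eventually.of_forall fun r => re_div_add_ofReal p r)

theorem re_b {p : ℂ} (hp : p ∈ Complex.slitPlane) :
    (b ν p).re = ∫ r in Ioi (0 : ℝ), (‖p‖ ^ 2 + r * p.re) / ‖p + (r : ℂ)‖ ^ 2 ∂ν := by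
  rw [b, ← integral_const_mul, ← RCLike.re_eq_complex_re,
    ← integral_re ((hν.integrableOn_one_div_add hp).const_mul p)]
  exact integral_congr_ae (Eventually.of_forall fun r => re_div_add_ofReal p r)

theorem integrableOn_im {p : ℂ} (hp : p ∈ Complex.slitPlane) :
    IntegrableOn (fun r : ℝ => r / ‖p + (r : ℂ)‖ ^ 2) (Ioi 0) ν := by
  obtain ⟨ε, hε, h⟩ := exists_mul_one_add_le_norm_add hp
  refine hν.integrableOn_of_norm_le (Measurable.aestronglyMeasurable
    (measurable_id.div ((continuous_add_ofReal p).norm.pow 2).measurable)) (ε ^ 2)⁻¹ fun r hr => ?_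
  have h1 := h r hr.le
  have h2 : (ε * (1 + r)) ^ 2 ≤ ‖p + (r : ℂ)‖ ^ 2 := pow_le_pow_left₀ (by positivity) h1 2
  have h3 : 0 < ‖p + (r : ℂ)‖ := lt_of_lt_of_le (by positivity) h1
  rw [Real.norm_of_nonneg (by positivity), ← one_div, div_mul_div_comm, one_mul,
    div_le_div_iff₀ (by positivity) (by positivity)]
  have : 0 ≤ ε ^ 2 * (1 + r) := by positivity
  nlinarith

theorem im_b {p : ℂ} (hp : p ∈ Complex.slitPlane) :
    (b ν p).im = p.im * ∫ r in Ioi (0 : ℝ), r / ‖p + (r : ℂ)‖ ^ 2 ∂ν := by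
  rw [b, ← integral_const_mul, ← integral_const_mul, ← RCLike.im_eq_complex_im,
    ← integral_im ((hν.integrableOn_one_div_add hp).const_mul p)]
  exact integral_congr_ae (Eventually.of_forall fun r => im_div_add_ofReal p r)

theorem re_b_nonneg {p : ℂ} (hp : 0 ≤ p.re) : 0 ≤ (b ν p).re := by
  rcases eq_or_ne p 0 with rfl | h0
  · simp [b]
  rw [hν.re_b (mem_slitPlane_of_re_nonneg hp h0)]
  refine setIntegral_nonneg measurableSet_Ioi fun r hr => ?_
  have : (0 : ℝ) < r := hr
  positivity

theorem tendsto_integral_atTop :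
    Tendsto (fun x : ℝ => ∫ r in Ioi (0 : ℝ), 1 / (x + r) ∂ν) atTop (𝓝 0) := by
  have h1 : Tendsto (fun x : ℝ => (x : ℂ)) atTop
      (Bornology.cobounded ℂ ⊓ 𝓟 {p : ℂ | 0 ≤ p.re}) := by
    refine tendsto_inf.2 ⟨?_, tendsto_principal.2 ?_⟩
    · rw [← tendsto_norm_atTop_iff_cobounded]
      simpa using tendsto_abs_atTop_atTop
    · filter_upwards [eventually_ge_atTop 0] with x hx
      simpa using hx
  have h2 := (Complex.continuous_re.tendsto 0).comp (hν.tendsto_integral_cobounded.comp h1)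
  refine h2.congr fun x => ?_
  simp only [Function.comp]
  rw [show (∫ r in Ioi (0 : ℝ), 1 / ((x : ℂ) + (r : ℂ)) ∂ν) =
    ((∫ r in Ioi (0 : ℝ), 1 / (x + r) ∂ν : ℝ) : ℂ) by
      rw [← integral_complex_ofReal]
      exact integral_congr_ae (Eventually.of_forall fun r => by push_cast; rfl), Complex.ofReal_re]

end Viscoelastic.IsSpectralMeasure

/-! ### From `[0,1]` to `]0,∞[` -/

/-- Undoing the compactification: the endpoints `u = 0` and `u = 1` give the constant and the
`1 / x` term, and the open interval gives a spectral measure. -/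
theorem exists_spectralMeasure_of_measure_unitInterval (m : Measure unitInterval)
    [IsFiniteMeasure m] :
    ∃ (a c : ℝ) (ν : Measure ℝ), 0 ≤ a ∧ 0 ≤ c ∧ IsSpectralMeasure ν ∧ ∀ x : Ioi (0 : ℝ),
      ∫ u, stieltjesKernel x u ∂m = a + c / x + ∫ r in Ioi (0 : ℝ), 1 / ((x : ℝ) + r) ∂ν := by
  set T : Set unitInterval := {u | u ≠ 0 ∧ u ≠ 1} with hT
  have hTm : MeasurableSet T :=
    (measurableSet_singleton (0 : unitInterval)).compl.inter (measurableSet_singleton 1).compl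
  have hTpos : ∀ u ∈ T, 0 < (u : ℝ) ∧ (u : ℝ) < 1 := fun u hu =>
    ⟨unitInterval.pos_iff_ne_zero.2 hu.1, unitInterval.lt_one_iff_ne_one.2 hu.2⟩
  have hdm : Measurable fun u : unitInterval => ENNReal.ofReal (1 / (u : ℝ)) := by fun_prop
  have hφ : Measurable fun u : unitInterval => (1 - (u : ℝ)) / u := by fun_prop
  set ν₀ := (m.restrict T).withDensity fun u => ENNReal.ofReal (1 / (u : ℝ))
  set ν := ν₀.map fun u : unitInterval => (1 - (u : ℝ)) / u with hν
  have hae : ∀ᵐ r ∂ν, r ∈ Ioi (0 : ℝ) := by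
    refine (ae_map_iff hφ.aemeasurable (p := fun r => r ∈ Ioi (0 : ℝ)) measurableSet_Ioi).2 ?_
    refine (withDensity_absolutelyContinuous _ _).ae_le ?_
    filter_upwards [ae_restrict_mem hTm] with u hu
    exact div_pos (sub_pos.2 (hTpos u hu).2) (hTpos u hu).1
  have hres : ν.restrict (Ioi 0) = ν := Measure.restrict_eq_self_of_ae_mem hae
  refine ⟨m.real {0}, m.real {1}, ν, by positivity, by positivity, ⟨?_, ?_⟩, fun x => ?_⟩
  · have : ∀ᵐ r ∂ν, r ∉ Iic (0 : ℝ) := hae.mono fun r (hr : 0 < r) => notMem_Iic.2 hr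
    simpa using measure_eq_zero_iff_ae_notMem.2 this
  · rw [hres, hν, lintegral_map (by fun_prop) hφ,
      lintegral_withDensity_eq_lintegral_mul _ hdm (by fun_prop)]
    refine lt_of_le_of_lt (b := ∫⁻ u in T, 1 ∂m) ?_ (by simp [measure_lt_top])
    refine setLIntegral_mono' hTm fun u hu => ?_
    have h1 := (hTpos u hu).1
    simp only [Pi.mul_apply]
    rw [← ENNReal.ofReal_mul (by positivity), ENNReal.ofReal_le_one]
    refine le_of_eq ?_
    field_simp
    ring
  · have hx : (0 : ℝ) < x := x.2
    have hki : Integrable (stieltjesKernel x) m :=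
      BoundedContinuousFunction.integrable m
        (BoundedContinuousFunction.mkOfCompact (stieltjesKernel x))
    have hc : ({0}ᶜ : Set unitInterval) = {1} ∪ T := by
      ext u
      by_cases h : u = 1 <;> simp [hT, h]
    rw [← integral_add_compl (measurableSet_singleton (0 : unitInterval)) hki, hc,
      setIntegral_union (by simp [hT]) hTm hki.integrableOn hki.integrableOn,
      integral_singleton, integral_singleton, hres, hν,
      integral_map hφ.aemeasurable (Measurable.aestronglyMeasurable (by fun_prop)),
      integral_withDensity_eq_integral_toReal_smul hdm (Eventually.of_forall fun _ => by simp)]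
    have h2 : ∫ u in T, stieltjesKernel x u ∂m = ∫ u in T,
        (ENNReal.ofReal (1 / (u : ℝ))).toReal • (1 / ((x : ℝ) + (1 - (u : ℝ)) / u)) ∂m := by
      refine setIntegral_congr_fun hTm fun u hu => ?_
      have h1 := (hTpos u hu).1
      have h3 := stieltjesKernel_denom_pos u hx
      simp only [stieltjesKernel, ContinuousMap.coe_mk, smul_eq_mul]
      rw [ENNReal.toReal_ofReal (by positivity)]
      have h4 : (x : ℝ) + (1 - (u : ℝ)) / u = (1 - u + u * x) / u := by field_simp; ring
      rw [h4]
      field_simp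
    rw [h2]
    simp [stieltjesKernel, div_eq_mul_inv]
    ring

/-! ### An integral representation on the slit plane -/

/-- The conformal map `z ↦ ((1 + z) / (1 - z))²` of the unit disc onto the slit plane. -/
noncomputable def discToSlit (z : ℂ) : ℂ := ((1 + z) / (1 - z)) ^ 2

theorem one_sub_ne_zero_of_norm_lt {z : ℂ} (hz : ‖z‖ < 1) : 1 - z ≠ 0 := by
  intro h
  rw [← sub_eq_zero.1 h, norm_one] at hz
  exact lt_irrefl _ hz

theorem re_cayley (z : ℂ) : ((1 + z) / (1 - z)).re = (1 - ‖z‖ ^ 2) / Complex.normSq (1 - z) := by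
  rw [← Complex.normSq_eq_norm_sq, Complex.div_re, ← add_div]
  congr 1
  simp [Complex.normSq_apply]
  ring

theorem im_cayley (z : ℂ) : ((1 + z) / (1 - z)).im = 2 * z.im / Complex.normSq (1 - z) := by
  rw [Complex.div_im, ← sub_div]
  congr 1
  simp
  ring

theorem re_cayley_pos {z : ℂ} (hz : ‖z‖ < 1) : 0 < ((1 + z) / (1 - z)).re := by
  rw [re_cayley]
  have h1 : ‖z‖ ^ 2 < 1 := by
    have := norm_nonneg z
    nlinarith
  exact div_pos (by linarith) (Complex.normSq_pos.2 (one_sub_ne_zero_of_norm_lt hz))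

theorem discToSlit_mem_slitPlane {z : ℂ} (hz : ‖z‖ < 1) : discToSlit z ∈ Complex.slitPlane := by
  have h := re_cayley_pos hz
  rw [discToSlit, Complex.mem_slitPlane_iff]
  set w := (1 + z) / (1 - z)
  rw [pow_two, Complex.mul_re, Complex.mul_im]
  rcases eq_or_ne w.im 0 with h0 | h0
  · left
    rw [h0]
    nlinarith
  · right
    have : w.re * w.im ≠ 0 := mul_ne_zero h.ne' h0
    intro h1
    apply this
    linarith

/-- The map `discToSlit` preserves the sign of the imaginary part. -/
theorem exists_im_discToSlit {z : ℂ} (hz : ‖z‖ < 1) :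
    ∃ c : ℝ, 0 < c ∧ (discToSlit z).im = c * z.im := by
  have h := re_cayley_pos hz
  have hN := Complex.normSq_pos.2 (one_sub_ne_zero_of_norm_lt hz)
  refine ⟨4 * ((1 + z) / (1 - z)).re / Complex.normSq (1 - z), by positivity, ?_⟩
  rw [discToSlit, pow_two, Complex.mul_im, im_cayley]
  ring

theorem differentiableAt_discToSlit {z : ℂ} (hz : ‖z‖ < 1) : DifferentiableAt ℂ discToSlit z := by
  unfold discToSlit
  exact ((differentiableAt_id.const_add 1).div (differentiableAt_id.const_sub 1)
    (one_sub_ne_zero_of_norm_lt hz)).pow 2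

theorem discToSlit_ofReal {x : ℝ} (hx : 0 < x) :
    discToSlit (((√x - 1) / (√x + 1) : ℝ) : ℂ) = x := by
  have h0 : (0 : ℝ) < √x + 1 := by positivity
  have h1 : ((1 + (√x - 1) / (√x + 1)) / (1 - (√x - 1) / (√x + 1))) ^ 2 = x := by
    have h2 : 1 - (√x - 1) / (√x + 1) = 2 / (√x + 1) := by field_simp; ring
    have h3 : 1 + (√x - 1) / (√x + 1) = 2 * √x / (√x + 1) := by field_simp; ring
    rw [h2, h3]
    have : 2 * √x / (√x + 1) / (2 / (√x + 1)) = √x := by field_simp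
    rw [this, Real.sq_sqrt hx.le]
  rw [discToSlit]
  exact_mod_cast congrArg (fun y : ℝ => (y : ℂ)) h1

theorem abs_cayley_sqrt_lt {x : ℝ} (hx : 0 < x) : |(√x - 1) / (√x + 1)| < 1 := by
  have h := Real.sqrt_pos.2 hx
  rw [abs_lt, lt_div_iff₀ (by positivity), div_lt_iff₀ (by positivity)]
  constructor <;> linarith

theorem one_sub_two_mul_cos_pos {w : ℝ} (hw : |w| < 1) (θ : ℝ) :
    0 < 1 - 2 * w * Real.cos θ + w ^ 2 := by
  have h1 := abs_lt.1 hw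
  rcases le_total 0 w with h | h
  · nlinarith [Real.cos_le_one θ]
  · nlinarith [Real.neg_one_le_cos θ]

/-- The difference of the Cauchy kernels at `w` and at the reflected point `1 / w` is real up to
the factor `-2i`. -/
theorem cauchy_kernel_sub {w : ℝ} (hw : |w| < 1) (θ : ℝ) :
    circleMap 0 1 θ * (circleMap 0 1 θ - w)⁻¹ - (1 - w * circleMap 0 1 θ)⁻¹ =
      -2 * Complex.I * ((Real.sin θ * (w / (1 - 2 * w * Real.cos θ + w ^ 2)) : ℝ) : ℂ) := by
  have hD := one_sub_two_mul_cos_pos hw θ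
  have hDC : ((1 - 2 * w * Real.cos θ + w ^ 2 : ℝ) : ℂ) ≠ 0 := by exact_mod_cast hD.ne'
  set ζ : ℂ := circleMap 0 1 θ with hζ
  have hζ' : ζ = (Real.cos θ : ℂ) + (Real.sin θ : ℂ) * Complex.I := by
    rw [hζ, circleMap]
    simp [Complex.exp_mul_I]
  have hnorm : ‖ζ‖ = 1 := by rw [hζ]; simp
  have h1 : ζ - w ≠ 0 := by
    intro h
    rw [sub_eq_zero.1 h, Complex.norm_real, Real.norm_eq_abs] at hnorm
    linarith
  have h2 : 1 - w * ζ ≠ 0 := by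
    intro h
    have h3 : ‖(w : ℂ) * ζ‖ = 1 := by rw [← sub_eq_zero.1 h, norm_one]
    rw [norm_mul, hnorm, Complex.norm_real, Real.norm_eq_abs] at h3
    linarith
  have hcs : (Real.cos θ : ℂ) ^ 2 + (Real.sin θ : ℂ) ^ 2 = 1 := by
    exact_mod_cast Real.cos_sq_add_sin_sq θ
  rw [← div_eq_mul_inv, ← one_div, div_sub_div _ _ h1 h2, Complex.ofReal_mul, Complex.ofReal_div,
    ← mul_div_assoc, ← mul_div_assoc, div_eq_div_iff (mul_ne_zero h1 h2) hDC]
  have hI := Complex.I_sq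
  simp only [Complex.ofReal_sub, Complex.ofReal_add, Complex.ofReal_mul, Complex.ofReal_pow,
    Complex.ofReal_one, Complex.ofReal_ofNat]
  rw [hζ'] at *
  generalize (Real.cos θ : ℂ) = c at *
  generalize (Real.sin θ : ℂ) = s at *
  have e1 : (c + s * Complex.I) * (1 - w * (c + s * Complex.I)) - (c + s * Complex.I - w) * 1 =
      -2 * Complex.I * (s * w) * (c + s * Complex.I) := by
    linear_combination (-w : ℂ) * hcs - (w : ℂ) * s ^ 2 * hI + 2 * (w : ℂ) * s ^ 2 * hI
  have e2 : (c + s * Complex.I - w) * (1 - w * (c + s * Complex.I)) =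
      (c + s * Complex.I) * (1 - 2 * w * c + w ^ 2) := by
    linear_combination (w : ℂ) * hcs - (w : ℂ) * s ^ 2 * hI
  rw [e1, e2]
  ring

/-- A Schwarz-type formula: on the real diameter, the real part of a holomorphic function is given
by the imaginary part on the circle. -/
theorem integral_im_mul_sin {h : ℂ → ℂ} (hd : DiffContOnCl ℂ h (Metric.ball 0 1)) {w : ℝ}
    (hw : |w| < 1) :
    ∫ θ in (0 : ℝ)..2 * Real.pi, (h (circleMap 0 1 θ)).im *
      (Real.sin θ * (w / (1 - 2 * w * Real.cos θ + w ^ 2))) =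
        Real.pi * ((h w).re - (h 0).re) := by
  have hcont : ContinuousOn h (Metric.closedBall 0 1) := by
    rw [← closure_ball (0 : ℂ) one_ne_zero]; exact hd.continuousOn
  have hhc : Continuous fun θ => h (circleMap 0 1 θ) :=
    hcont.comp_continuous (continuous_circleMap 0 1)
      (fun θ => Metric.sphere_subset_closedBall (circleMap_mem_sphere 0 zero_le_one θ))
  have hball : (w : ℂ) ∈ Metric.ball (0 : ℂ) 1 := by simpa using hw
  have hne : ∀ z ∈ Metric.closedBall (0 : ℂ) 1, 1 - w * z ≠ 0 := by
    intro z hz h0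
    have h3 : ‖(w : ℂ) * z‖ = 1 := by rw [← sub_eq_zero.1 h0, norm_one]
    rw [mem_closedBall_zero_iff] at hz
    rw [norm_mul, Complex.norm_real, Real.norm_eq_abs] at h3
    have := mul_le_mul_of_nonneg_left hz (abs_nonneg w)
    linarith
  have hd2 : DiffContOnCl ℂ (fun z : ℂ => (1 - (w : ℂ) * z)⁻¹ * h z) (Metric.ball 0 1) := by
    refine ⟨fun z hz => ?_, ?_⟩
    · have h1 : DifferentiableAt ℂ (fun z : ℂ => (1 - w * z)⁻¹) z :=
        DifferentiableAt.inv (by fun_prop) (hne z (Metric.ball_subset_closedBall hz))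
      exact (h1.mul (hd.differentiableAt Metric.isOpen_ball hz)).differentiableWithinAt
    · rw [closure_ball (0 : ℂ) one_ne_zero]
      exact ContinuousOn.mul (ContinuousOn.inv₀ (by fun_prop) hne) hcont
  have c1 := hd.circleIntegral_sub_inv_smul hball
  have c2 := hd2.circleIntegral_sub_inv_smul (Metric.mem_ball_self one_pos)
  simp only [circleIntegral, deriv_circleMap, smul_eq_mul, sub_zero, mul_zero, inv_one,
    one_mul] at c1 c2
  have hne1 : ∀ θ, circleMap 0 1 θ - (w : ℂ) ≠ 0 := fun θ h0 => by
    have : ‖circleMap 0 1 θ‖ = 1 := by simp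
    rw [sub_eq_zero.1 h0, Complex.norm_real, Real.norm_eq_abs] at this
    linarith
  have hcm : Continuous (circleMap 0 1) := continuous_circleMap 0 1
  have i1 : IntervalIntegrable (fun θ => circleMap 0 1 θ * Complex.I *
      ((circleMap 0 1 θ - (w : ℂ))⁻¹ * h (circleMap 0 1 θ))) volume 0 (2 * Real.pi) :=
    ((hcm.mul continuous_const).mul
      (((hcm.sub continuous_const).inv₀ hne1).mul hhc)).intervalIntegrable _ _
  have i2 : IntervalIntegrable (fun θ => circleMap 0 1 θ * Complex.I *
      ((circleMap 0 1 θ)⁻¹ * ((1 - w * circleMap 0 1 θ)⁻¹ * h (circleMap 0 1 θ))))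
      volume 0 (2 * Real.pi) := by
    refine ((hcm.mul continuous_const).mul
      ((hcm.inv₀ fun θ => circleMap_ne_center one_ne_zero).mul
        (((continuous_const.sub (continuous_const.mul hcm)).inv₀ fun θ => hne _
          (Metric.sphere_subset_closedBall (circleMap_mem_sphere 0 zero_le_one θ))).mul
          hhc))).intervalIntegrable _ _
  have c3 := (intervalIntegral.integral_sub i1 i2).trans (congrArg₂ (· - ·) c1 c2)
  have hpt : ∀ θ, circleMap 0 1 θ * Complex.I *
      ((circleMap 0 1 θ - (w : ℂ))⁻¹ * h (circleMap 0 1 θ)) - circleMap 0 1 θ * Complex.I *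
      ((circleMap 0 1 θ)⁻¹ * ((1 - w * circleMap 0 1 θ)⁻¹ * h (circleMap 0 1 θ))) =
      2 * (h (circleMap 0 1 θ) *
        ((Real.sin θ * (w / (1 - 2 * w * Real.cos θ + w ^ 2)) : ℝ) : ℂ)) := by
    intro θ
    have hz : circleMap 0 1 θ ≠ 0 := circleMap_ne_center one_ne_zero
    have e1 : circleMap 0 1 θ * Complex.I *
      ((circleMap 0 1 θ)⁻¹ * ((1 - w * circleMap 0 1 θ)⁻¹ * h (circleMap 0 1 θ))) =
      Complex.I * ((1 - w * circleMap 0 1 θ)⁻¹ * h (circleMap 0 1 θ)) := by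
      field_simp
    rw [e1]
    linear_combination (Complex.I * h (circleMap 0 1 θ)) * cauchy_kernel_sub hw θ -
      2 * (h (circleMap 0 1 θ) *
        ((Real.sin θ * (w / (1 - 2 * w * Real.cos θ + w ^ 2)) : ℝ) : ℂ)) * Complex.I_sq
  simp only [hpt] at c3
  rw [intervalIntegral.integral_const_mul] at c3
  have c4 : ∫ θ in (0 : ℝ)..2 * Real.pi, h (circleMap 0 1 θ) *
        ((Real.sin θ * (w / (1 - 2 * w * Real.cos θ + w ^ 2)) : ℝ) : ℂ) =
      Real.pi * Complex.I * (h w - h 0) := by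
    linear_combination c3 / 2
  have hκ : Continuous fun θ => Real.sin θ * (w / (1 - 2 * w * Real.cos θ + w ^ 2)) :=
    Real.continuous_sin.mul (continuous_const.div (by fun_prop)
      fun θ => (one_sub_two_mul_cos_pos hw θ).ne')
  have c5 := congrArg Complex.im c4
  have i3 : IntervalIntegrable (fun θ => h (circleMap 0 1 θ) *
        ((Real.sin θ * (w / (1 - 2 * w * Real.cos θ + w ^ 2)) : ℝ) : ℂ)) volume 0 (2 * Real.pi) :=
    (hhc.mul (Complex.continuous_ofReal.comp hκ)).intervalIntegrable _ _
  have c6 := Complex.imCLM.intervalIntegral_comp_comm i3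
  simp only [Complex.imCLM_apply, Complex.im_mul_ofReal] at c6
  rw [c6, c5]
  simp

/-- The position on `[0,1]` of the boundary point `exp (iθ)`. -/
noncomputable def anglePoint (θ : ℝ) : unitInterval :=
  projIcc 0 1 zero_le_one ((1 - Real.cos θ) / 2)

theorem coe_anglePoint (θ : ℝ) : (anglePoint θ : ℝ) = (1 - Real.cos θ) / 2 := by
  rw [anglePoint, projIcc_of_mem]
  constructor <;> linarith [Real.cos_le_one θ, Real.neg_one_le_cos θ]

theorem continuous_anglePoint : Continuous anglePoint :=
  continuous_projIcc.comp (by fun_prop)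

/-- The kernel on the circle at `w = (√x - 1) / (√x + 1)`, the preimage of `x` in the disc, is a
multiple of the Stieltjes kernel at `x`, with `u = (1 - cos θ) / 2`. -/
theorem kernel_anglePoint {x : ℝ} (hx : 0 < x) (θ : ℝ) :
    (x - 1) / 4 * (1 - (anglePoint θ : ℝ) + anglePoint θ * x)⁻¹ =
      (√x - 1) / (√x + 1) / (1 - 2 * ((√x - 1) / (√x + 1)) * Real.cos θ +
        ((√x - 1) / (√x + 1)) ^ 2) := by
  have h1 := one_sub_two_mul_cos_pos (abs_cayley_sqrt_lt hx) θ
  have h2 := stieltjesKernel_denom_pos (anglePoint θ) hx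
  rw [coe_anglePoint] at *
  obtain ⟨y, hy, rfl⟩ : ∃ y : ℝ, 0 < y ∧ x = y ^ 2 :=
    ⟨√x, Real.sqrt_pos.2 hx, (Real.sq_sqrt hx.le).symm⟩
  rw [Real.sqrt_sq hy.le] at *
  have hy1 : y + 1 ≠ 0 := by positivity
  have h3 : 1 - 2 * ((y - 1) / (y + 1)) * Real.cos θ + ((y - 1) / (y + 1)) ^ 2 =
      4 * (1 - (1 - Real.cos θ) / 2 + (1 - Real.cos θ) / 2 * y ^ 2) / (y + 1) ^ 2 := by
    field_simp; ring
  rw [h3]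
  field_simp
  ring

/-- The measure representing a typically real function that is continuous up to the circle. -/
theorem exists_measure_of_im_mul_sin_nonpos {h : ℂ → ℂ} (hd : DiffContOnCl ℂ h (Metric.ball 0 1))
    (hsign : ∀ θ, (h (circleMap 0 1 θ)).im * Real.sin θ ≤ 0) :
    ∃ m : Measure unitInterval, IsFiniteMeasure m ∧ ∀ x : Ioi (0 : ℝ),
      ∫ u, ((x : ℝ) - 1) / 4 * stieltjesKernel x u ∂m =
        (h 0).re - (h (((√(x : ℝ) - 1) / (√(x : ℝ) + 1) : ℝ) : ℂ)).re := by
  have hcont : ContinuousOn h (Metric.closedBall 0 1) := by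
    rw [← closure_ball (0 : ℂ) one_ne_zero]; exact hd.continuousOn
  have hhc : Continuous fun θ => h (circleMap 0 1 θ) :=
    hcont.comp_continuous (continuous_circleMap 0 1)
      (fun θ => Metric.sphere_subset_closedBall (circleMap_mem_sphere 0 zero_le_one θ))
  set d : ℝ → ℝ := fun θ => -(Real.pi⁻¹ * ((h (circleMap 0 1 θ)).im * Real.sin θ)) with hd'
  have hdc : Continuous d := by
    have := Complex.continuous_im.comp hhc
    exact (continuous_const.mul (this.mul Real.continuous_sin)).neg
  have hd0 : ∀ θ, 0 ≤ d θ := fun θ => by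
    have := mul_nonneg (inv_pos.2 Real.pi_pos).le (neg_nonneg.2 (hsign θ))
    simp only [hd']; linarith
  have hdm : Measurable fun θ => ENNReal.ofReal (d θ) := hdc.measurable.ennreal_ofReal
  have hdi : IntegrableOn d (Ioc 0 (2 * Real.pi)) :=
    (hdc.integrableOn_Icc (a := 0) (b := 2 * Real.pi)).mono_set Ioc_subset_Icc_self
  have hfin : IsFiniteMeasure ((volume.restrict (Ioc 0 (2 * Real.pi))).withDensity
      fun θ => ENNReal.ofReal (d θ)) := isFiniteMeasure_withDensity_ofReal hdi.2
  refine ⟨((volume.restrict (Ioc 0 (2 * Real.pi))).withDensity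
      fun θ => ENNReal.ofReal (d θ)).map anglePoint, inferInstance, fun x => ?_⟩
  have hkc : Continuous fun u => ((x : ℝ) - 1) / 4 * stieltjesKernel x u :=
    continuous_const.mul (stieltjesKernel x).continuous
  rw [integral_map continuous_anglePoint.measurable.aemeasurable hkc.aestronglyMeasurable,
    integral_withDensity_eq_integral_toReal_smul hdm (Eventually.of_forall fun _ => by simp),
    ← intervalIntegral.integral_of_le (by positivity)]
  have key := integral_im_mul_sin hd (abs_cayley_sqrt_lt x.2)
  have hpt : ∀ θ, (ENNReal.ofReal (d θ)).toReal • (((x : ℝ) - 1) / 4 *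
      stieltjesKernel x (anglePoint θ)) = -Real.pi⁻¹ * ((h (circleMap 0 1 θ)).im *
      (Real.sin θ * ((√(x : ℝ) - 1) / (√(x : ℝ) + 1) /
        (1 - 2 * ((√(x : ℝ) - 1) / (√(x : ℝ) + 1)) * Real.cos θ +
        ((√(x : ℝ) - 1) / (√(x : ℝ) + 1)) ^ 2)))) := fun θ => by
    rw [ENNReal.toReal_ofReal (hd0 θ), ← kernel_anglePoint x.2]
    simp only [hd', smul_eq_mul, stieltjesKernel, ContinuousMap.coe_mk]
    ring
  simp only [hpt]
  rw [intervalIntegral.integral_const_mul, key]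
  field_simp
  ring

/-- The representation on circles of radius `R < 1`, and compactness as `R → 1`. -/
theorem exists_measure_sub_eq_integral {S : ℂ → ℂ} (hS : DifferentiableOn ℂ S Complex.slitPlane)
    (hup : ∀ p : ℂ, 0 < p.im → (S p).im ≤ 0) (hlow : ∀ p : ℂ, p.im < 0 → 0 ≤ (S p).im)
    (hre : ∀ x : ℝ, 0 < x → 0 ≤ (S x).re) :
    ∃ μ : Measure unitInterval, IsFiniteMeasure μ ∧ ∀ x : Ioi (0 : ℝ),
      ∫ u, ((x : ℝ) - 1) / 4 * stieltjesKernel x u ∂μ = (S 1).re - (S (x : ℝ)).re := by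
  set R : ℕ → ℝ := fun n => (n + 1) / (n + 2) with hR
  have hR0 : ∀ n, 0 < R n := fun n => by simp only [hR]; positivity
  have hR1 : ∀ n, R n < 1 := fun n => by
    simp only [hR]; rw [div_lt_one (by positivity)]; linarith
  have hRlim : Tendsto R atTop (𝓝 1) := by
    have := (tendsto_natCast_div_add_atTop (1 : ℝ)).comp (tendsto_add_atTop_nat 1)
    refine this.congr fun n => ?_
    simp only [Function.comp, hR]; push_cast; ring_nf
  have hnorm : ∀ n (z : ℂ), ‖z‖ ≤ 1 → ‖(R n : ℂ) * z‖ < 1 := fun n z hz => by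
    rw [norm_mul, Complex.norm_real, Real.norm_of_nonneg (hR0 n).le]
    calc R n * ‖z‖ ≤ R n * 1 := mul_le_mul_of_nonneg_left hz (hR0 n).le
      _ < 1 := by linarith [hR1 n]
  have hSd : ∀ z : ℂ, ‖z‖ < 1 → DifferentiableAt ℂ (fun z => S (discToSlit z)) z := fun z hz =>
    DifferentiableAt.comp z (hS.differentiableAt
      (Complex.isOpen_slitPlane.mem_nhds (discToSlit_mem_slitPlane hz)))
      (differentiableAt_discToSlit hz)
  set h : ℕ → ℂ → ℂ := fun n z => S (discToSlit (R n * z)) with hh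
  have hhd : ∀ n (z : ℂ), ‖z‖ ≤ 1 → DifferentiableAt ℂ (h n) z := fun n z hz =>
    DifferentiableAt.comp (g := fun z => S (discToSlit z)) z (hSd _ (hnorm n z hz)) (by fun_prop)
  have hdc : ∀ n, DiffContOnCl ℂ (h n) (Metric.ball 0 1) := fun n => by
    refine DifferentiableOn.diffContOnCl fun z hz => ?_
    rw [closure_ball (0 : ℂ) one_ne_zero, mem_closedBall_zero_iff] at hz
    exact (hhd n z hz).differentiableWithinAt
  have hsign : ∀ n θ, (h n (circleMap 0 1 θ)).im * Real.sin θ ≤ 0 := fun n θ => by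
    have hlt : ‖(R n : ℂ) * circleMap 0 1 θ‖ < 1 := hnorm n _ (by simp)
    obtain ⟨c, hc, him⟩ := exists_im_discToSlit hlt
    have him' : (discToSlit (R n * circleMap 0 1 θ)).im = c * (R n * Real.sin θ) := by
      rw [him, Complex.im_ofReal_mul]
      simp [circleMap, Complex.exp_ofReal_mul_I_im]
    rcases lt_trichotomy (Real.sin θ) 0 with hs | hs | hs
    · refine mul_nonpos_of_nonneg_of_nonpos (hlow _ ?_) hs.le
      rw [him']
      exact mul_neg_of_pos_of_neg hc (mul_neg_of_pos_of_neg (hR0 n) hs)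
    · rw [hs, mul_zero]
    · refine mul_nonpos_of_nonpos_of_nonneg (hup _ ?_) hs.le
      rw [him']
      exact mul_pos hc (mul_pos (hR0 n) hs)
  choose m hmfin hm using fun n => exists_measure_of_im_mul_sin_nonpos (hdc n) (hsign n)
  have hh0 : ∀ n, h n 0 = S 1 := fun n => by simp [hh, discToSlit]
  have hreal : ∀ n (x : Ioi (0 : ℝ)),
      0 ≤ (h n (((√(x : ℝ) - 1) / (√(x : ℝ) + 1) : ℝ) : ℂ)).re := fun n x => by
    have hw := abs_cayley_sqrt_lt x.2
    set w : ℝ := (√(x : ℝ) - 1) / (√(x : ℝ) + 1)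
    have h1 : |R n * w| < 1 := by
      simpa using hnorm n w (by simpa using hw.le)
    have h2 : discToSlit ((R n : ℂ) * w) = (((1 + R n * w) / (1 - R n * w)) ^ 2 : ℝ) := by
      rw [discToSlit]; push_cast; rfl
    simp only [hh]
    rw [h2]
    have := abs_lt.1 h1
    exact hre _ (pow_pos (div_pos (by linarith) (by linarith)) 2)
  have hint : ∀ n (x : Ioi (0 : ℝ)),
      Integrable (fun u => ((x : ℝ) - 1) / 4 * stieltjesKernel x u) (m n) :=
    fun n x => (BoundedContinuousFunction.integrable (m n)
      (BoundedContinuousFunction.mkOfCompact (stieltjesKernel x))).const_mul _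
  -- the representation at `x = 2`, where the kernel is at least `1 / 8`, bounds the masses
  have hmass : ∀ n, m n univ ≤ (8 * (S 1).re).toNNReal := fun n => by
    have h2 : (0 : ℝ) < 2 := two_pos
    have e1 := hm n ⟨2, h2⟩
    have e2 : ∫ _u : unitInterval, (1 / 8 : ℝ) ∂m n ≤ _ :=
      integral_mono (integrable_const _) (hint n ⟨2, h2⟩) fun u => by
        have h3 := stieltjesKernel_denom_pos u h2
        simp only [stieltjesKernel, ContinuousMap.coe_mk]
        rw [← one_div, div_mul_div_comm, div_le_div_iff₀ (by norm_num) (by linarith)]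
        linarith [u.2.2]
    rw [integral_const, smul_eq_mul, e1, hh0] at e2
    have e3 := hreal n ⟨2, h2⟩
    rw [← ENNReal.ofReal_toReal (measure_ne_top (m n) univ)]
    refine ENNReal.ofReal_le_ofReal ?_
    change (m n).real univ ≤ _
    simp only at e2 e3
    linarith
  refine exists_measure_integral_eq (fun x : Ioi (0 : ℝ) =>
    (((x : ℝ) - 1) / 4) • stieltjesKernel x) m _ hmass _ fun x => ?_
  simp only [ContinuousMap.coe_smul, Pi.smul_apply, smul_eq_mul]
  simp only [hm, hh0]
  refine tendsto_const_nhds.sub ?_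
  have hw := abs_cayley_sqrt_lt x.2
  have hlim : Tendsto (fun n => (R n : ℂ) * (((√(x : ℝ) - 1) / (√(x : ℝ) + 1) : ℝ) : ℂ)) atTop
      (𝓝 (((√(x : ℝ) - 1) / (√(x : ℝ) + 1) : ℝ) : ℂ)) := by
    simpa using ((Complex.continuous_ofReal.tendsto 1).comp hRlim).mul_const
      ((((√(x : ℝ) - 1) / (√(x : ℝ) + 1) : ℝ) : ℂ))
  have h1 := ((hSd _ (by rwa [Complex.norm_real, Real.norm_eq_abs])).continuousAt.tendsto.comp hlim)
  have h2 := (Complex.continuous_re.tendsto _).comp h1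
  rw [discToSlit_ofReal x.2] at h2
  exact h2

/-- A holomorphic function on the slit plane that is non-negative on `]0,∞[` and maps each of the
two half-planes into the opposite closed one is a Stieltjes function. -/
theorem exists_integral_stieltjesKernel_eq {S : ℂ → ℂ}
    (hS : DifferentiableOn ℂ S Complex.slitPlane)
    (hup : ∀ p : ℂ, 0 < p.im → (S p).im ≤ 0) (hlow : ∀ p : ℂ, p.im < 0 → 0 ≤ (S p).im)
    (hre : ∀ x : ℝ, 0 < x → 0 ≤ (S x).re) :
    ∃ μ : Measure unitInterval, IsFiniteMeasure μ ∧ ∀ x : Ioi (0 : ℝ),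
      ∫ u, stieltjesKernel x u ∂μ = (S (x : ℝ)).re := by
  obtain ⟨m, hmfin, hm⟩ := exists_measure_sub_eq_integral hS hup hlow hre
  have hS1 : 0 ≤ (S 1).re := by simpa using hre 1 one_pos
  -- non-negativity of `S` at infinity makes `1 / u` integrable
  have hfatou : ∫⁻ u : unitInterval, (ENNReal.ofReal (u : ℝ))⁻¹ ∂m ≤
      ENNReal.ofReal (4 * (S 1).re) := by
    have hlim : ∀ u : unitInterval, Tendsto (fun n : ℕ =>
        (ENNReal.ofReal (1 / ((n : ℝ) + 1) + u))⁻¹) atTop (𝓝 (ENNReal.ofReal (u : ℝ))⁻¹) :=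
      fun u => by
        have h1 := (tendsto_one_div_add_atTop_nhds_zero_nat (𝕜 := ℝ)).add_const (u : ℝ)
        rw [zero_add] at h1
        exact tendsto_inv_iff.2 ((ENNReal.continuous_ofReal.tendsto _).comp h1)
    have hle : ∀ n : ℕ, ∫⁻ u : unitInterval, (ENNReal.ofReal (1 / ((n : ℝ) + 1) + u))⁻¹ ∂m ≤
        ENNReal.ofReal (4 * (S 1).re) := fun n => by
      have hn : (0 : ℝ) < n + 1 := by positivity
      have hx : (0 : ℝ) < n + 2 := by positivity
      have hk : ∀ u : unitInterval, (ENNReal.ofReal (1 / ((n : ℝ) + 1) + u))⁻¹ =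
          ENNReal.ofReal (4 * (((n + 2 : ℝ) - 1) / 4 * stieltjesKernel ⟨n + 2, hx⟩ u)) :=
          fun u => by
        have h0 := u.2.1
        have h1 := stieltjesKernel_denom_pos u hx
        rw [← ENNReal.ofReal_inv_of_pos (by positivity)]
        congr 1
        simp only [stieltjesKernel, ContinuousMap.coe_mk]
        rw [show 1 / ((n : ℝ) + 1) + u = (1 - (u : ℝ) + u * (n + 2)) / (n + 1) by field_simp; ring,
          inv_div]
        field_simp
        ring
      simp only [hk]
      rw [← ofReal_integral_eq_lintegral_ofReal]
      · rw [integral_const_mul, hm ⟨n + 2, hx⟩]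
        refine ENNReal.ofReal_le_ofReal ?_
        have := hre (n + 2) hx
        simp only at this ⊢
        linarith
      · exact ((BoundedContinuousFunction.integrable m (BoundedContinuousFunction.mkOfCompact
          (stieltjesKernel ⟨n + 2, hx⟩))).const_mul _).const_mul _
      · refine Eventually.of_forall fun u => ?_
        have h1 := stieltjesKernel_denom_pos u hx
        simp only [stieltjesKernel, ContinuousMap.coe_mk, Pi.zero_apply]
        have : (0 : ℝ) ≤ (n + 2 : ℝ) - 1 := by linarith
        positivity
    calc ∫⁻ u : unitInterval, (ENNReal.ofReal (u : ℝ))⁻¹ ∂m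
        = ∫⁻ u : unitInterval, liminf (fun n : ℕ =>
            (ENNReal.ofReal (1 / ((n : ℝ) + 1) + u))⁻¹) atTop ∂m := by
          simp only [(hlim _).liminf_eq]
      _ ≤ liminf (fun n : ℕ => ∫⁻ u : unitInterval,
            (ENNReal.ofReal (1 / ((n : ℝ) + 1) + u))⁻¹ ∂m) atTop :=
          lintegral_liminf_le fun n => by fun_prop
      _ ≤ ENNReal.ofReal (4 * (S 1).re) :=
          liminf_le_of_le (by isBoundedDefault) fun c hc => by
            obtain ⟨n, hn⟩ := hc.exists
            exact hn.trans (hle n)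
  have hmeas : Measurable fun u : unitInterval => (ENNReal.ofReal (u : ℝ))⁻¹ := by fun_prop
  have hpos : ∀ᵐ u ∂m, (0 : ℝ) < (u : unitInterval) := by
    filter_upwards [ae_lt_top hmeas (hfatou.trans_lt ENNReal.ofReal_lt_top).ne] with u hu
    simpa using hu
  have hinv : ∀ᵐ u ∂m, (ENNReal.ofReal ((u : unitInterval) : ℝ))⁻¹ =
      ENNReal.ofReal (1 / (u : ℝ)) := by
    filter_upwards [hpos] with u hu
    rw [one_div, ENNReal.ofReal_inv_of_pos hu]
  have hlint : ∫⁻ u : unitInterval, ENNReal.ofReal (1 / (u : ℝ)) ∂m ≤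
      ENNReal.ofReal (4 * (S 1).re) := by rwa [← lintegral_congr_ae hinv]
  have hnn : ∀ u : unitInterval, 0 ≤ 1 / (u : ℝ) := fun u => one_div_nonneg.2 u.2.1
  have hI : Integrable (fun u : unitInterval => 1 / (u : ℝ)) m := by
    refine ⟨Measurable.aestronglyMeasurable (by fun_prop), ?_⟩
    rw [hasFiniteIntegral_iff_ofReal (Eventually.of_forall hnn)]
    exact hlint.trans_lt ENNReal.ofReal_lt_top
  have hIle : ∫ u : unitInterval, 1 / (u : ℝ) ∂m ≤ 4 * (S 1).re := by
    rw [← ENNReal.ofReal_le_ofReal_iff (by positivity),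
      ofReal_integral_eq_lintegral_ofReal hI (Eventually.of_forall hnn)]
    exact hlint
  have hdm : Measurable fun u : unitInterval => ENNReal.ofReal (1 / 4 * (1 / (u : ℝ))) := by
    fun_prop
  have hfin1 : IsFiniteMeasure (m.withDensity fun u => ENNReal.ofReal (1 / 4 * (1 / (u : ℝ)))) :=
    isFiniteMeasure_withDensity_ofReal (hI.const_mul _).2
  set a := (S 1).re - 1 / 4 * ∫ u : unitInterval, 1 / (u : ℝ) ∂m with ha
  have ha0 : 0 ≤ a := by rw [ha]; linarith
  have hfin2 : IsFiniteMeasure (ENNReal.ofReal a • Measure.dirac (0 : unitInterval)) :=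
    Measure.smul_finite _ ENNReal.ofReal_ne_top
  refine ⟨ENNReal.ofReal a • Measure.dirac 0 +
    m.withDensity fun u => ENNReal.ofReal (1 / 4 * (1 / (u : ℝ))), inferInstance, fun x => ?_⟩
  have hx : (0 : ℝ) < x := x.2
  have hki : ∀ (ν : Measure unitInterval) [IsFiniteMeasure ν], Integrable (stieltjesKernel x) ν :=
    fun ν _ => BoundedContinuousFunction.integrable ν
      (BoundedContinuousFunction.mkOfCompact (stieltjesKernel x))
  rw [integral_add_measure (hki _) (hki _),
    integral_withDensity_eq_integral_toReal_smul hdm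
      (Eventually.of_forall fun _ => ENNReal.ofReal_lt_top),
    integral_smul_measure, integral_dirac, ENNReal.toReal_ofReal ha0]
  have e1 : ∫ u : unitInterval, (ENNReal.ofReal (1 / 4 * (1 / (u : ℝ)))).toReal •
      stieltjesKernel x u ∂m = ∫ u : unitInterval, (1 / 4 * (1 / (u : ℝ)) -
        ((x : ℝ) - 1) / 4 * stieltjesKernel x u) ∂m := by
    refine integral_congr_ae ?_
    filter_upwards [hpos] with u hu
    have h1 := stieltjesKernel_denom_pos u hx
    rw [ENNReal.toReal_ofReal (by positivity)]
    simp only [stieltjesKernel, ContinuousMap.coe_mk, smul_eq_mul]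
    field_simp
    ring
  rw [e1, integral_sub (hI.const_mul _) ((hki m).const_mul _), hm, integral_const_mul]
  simp [stieltjesKernel, ha]

/-! ### Complete Bernstein functions -/

theorem one_sub_exp_neg_mul_div_le {r : ℝ} (hr : 0 < r) (t : ℝ) :
    (1 - Real.exp (-(r * t))) / r ≤ (1 + t) * (1 / (1 + r)) := by
  have h1 := Real.add_one_le_exp (-(r * t))
  have h2 := Real.exp_pos (-(r * t))
  rw [mul_one_div, div_le_div_iff₀ hr (by positivity)]
  nlinarith

theorem exp_neg_mul_le {r t : ℝ} (hr : 0 ≤ r) (ht : 0 < t) :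
    Real.exp (t * -r) ≤ (1 + 1 / t) * (1 / (1 + r)) := by
  have h1 := Real.add_one_le_exp (t * r)
  rw [mul_neg, Real.exp_neg, mul_one_div, inv_le_comm₀ (Real.exp_pos _) (by positivity), inv_div,
    div_le_iff₀ (by positivity)]
  have h2 : 0 ≤ t * r := by positivity
  calc 1 + r ≤ (t * r + 1) * (1 + 1 / t) := by
        have : (t * r + 1) * (1 + 1 / t) = t * r + 1 + r + 1 / t := by field_simp; ring
        rw [this]
        have : 0 ≤ 1 / t := by positivity
        linarith
    _ ≤ _ := by gcongr

theorem lintegral_exp_mul_one_sub_exp {x r : ℝ} (hx : 0 < x) (hr : 0 < r) :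
    ∫⁻ t in Ioi (0 : ℝ), ENNReal.ofReal (Real.exp (-(x * t)) * ((1 - Real.exp (-(r * t))) / r)) =
      ENNReal.ofReal (1 / x * (1 / (x + r))) := by
  have hxr : 0 < x + r := by positivity
  have h1 : ∀ t, Real.exp (-(x * t)) * ((1 - Real.exp (-(r * t))) / r) =
      Real.exp (-(x * t)) * r⁻¹ - Real.exp (-((x + r) * t)) * r⁻¹ := fun t => by
    rw [show -((x + r) * t) = -(x * t) + -(r * t) by ring, Real.exp_add]
    ring
  rw [← ofReal_integral_eq_lintegral_ofReal]
  · simp only [h1]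
    rw [integral_sub (integrableOn_exp_neg_mul hx _) (integrableOn_exp_neg_mul hxr _),
      integral_mul_const, integral_mul_const, integral_exp_neg_mul hx, integral_exp_neg_mul hxr]
    congr 1
    field_simp
    ring
  · simp only [h1]
    exact (integrableOn_exp_neg_mul hx _).sub (integrableOn_exp_neg_mul hxr _)
  · filter_upwards [ae_restrict_mem measurableSet_Ioi] with t ht
    have ht' : (0 : ℝ) < t := ht
    have : Real.exp (-(r * t)) ≤ 1 := Real.exp_le_one_iff.2 (by have := mul_pos hr ht'; linarith)
    exact mul_nonneg (Real.exp_pos _).le (div_nonneg (by linarith) hr.le)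

namespace Viscoelastic.IsSpectralMeasure

variable {ν : Measure ℝ} (hν : IsSpectralMeasure ν)
include hν

/-- A spectral measure has a positive integrable function, hence is σ-finite, as Tonelli's theorem
requires. -/
theorem sigmaFinite_restrict : SigmaFinite (ν.restrict (Ioi 0)) := by
  have hfin : IsFiniteMeasure ((ν.restrict (Ioi 0)).withDensity
      fun r => ENNReal.ofReal (1 / (1 + r))) :=
    isFiniteMeasure_withDensity hν.2.ne
  have h := withDensity_inv_same₀ (μ := ν.restrict (Ioi 0))
    (f := fun r => ENNReal.ofReal (1 / (1 + r))) (by fun_prop)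
    ((ae_restrict_mem measurableSet_Ioi).mono fun r (hr : 0 < r) => by simp; positivity)
    (Eventually.of_forall fun _ => ENNReal.ofReal_ne_top)
  rw [← h]
  refine SigmaFinite.withDensity_of_ne_top ?_
  refine (withDensity_absolutelyContinuous _ _).ae_le ?_
  filter_upwards [ae_restrict_mem measurableSet_Ioi] with r hr
  have hr' : (0 : ℝ) < r := hr
  simp
  positivity

theorem Ioi_subset_interior_integrableExpSet :
    Ioi 0 ⊆ interior (ProbabilityTheory.integrableExpSet (fun r => -r) (ν.restrict (Ioi 0))) := by
  refine isOpen_Ioi.subset_interior_iff.2 fun t ht => ?_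
  refine hν.integrableOn_of_norm_le (Measurable.aestronglyMeasurable (by fun_prop)) (1 + 1 / t)
    fun r hr => ?_
  rw [Real.norm_of_nonneg (Real.exp_pos _).le]
  exact exp_neg_mul_le hr.le ht

/-- The Laplace transform `t ↦ ∫ exp (-r t) ν(dr)`, written as a moment generating function. -/
theorem isCompletelyMonotone_mgf :
    IsCompletelyMonotone (ProbabilityTheory.mgf (fun r => -r) (ν.restrict (Ioi 0))) := by
  have hsub := hν.Ioi_subset_interior_integrableExpSet
  refine ⟨(ProbabilityTheory.analyticOn_mgf.mono hsub).contDiffOn (uniqueDiffOn_Ioi 0),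
    fun n t ht => ?_⟩
  rw [ProbabilityTheory.iteratedDeriv_mgf (hsub ht), ← integral_const_mul]
  refine setIntegral_nonneg measurableSet_Ioi fun r hr => ?_
  have hr' : (0 : ℝ) < r := hr
  rw [← mul_assoc, ← mul_pow]
  have : (0 : ℝ) ≤ -1 * -r := by linarith
  positivity

theorem integrableOn_one_sub_exp {t : ℝ} (ht : 0 ≤ t) :
    IntegrableOn (fun r => (1 - Real.exp (-(r * t))) / r) (Ioi 0) ν := by
  refine hν.integrableOn_of_norm_le (Measurable.aestronglyMeasurable (by fun_prop)) (1 + t)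
    fun r hr => ?_
  have : Real.exp (-(r * t)) ≤ 1 := Real.exp_le_one_iff.2 (by have := mul_nonneg hr.le ht; linarith)
  rw [Real.norm_of_nonneg (div_nonneg (by linarith) hr.le)]
  exact one_sub_exp_neg_mul_div_le hr t

theorem hasDerivAt_integral_one_sub_exp {t : ℝ} (ht : 0 < t) :
    HasDerivAt (fun t => ∫ r in Ioi (0 : ℝ), (1 - Real.exp (-(r * t))) / r ∂ν)
      (ProbabilityTheory.mgf (fun r => -r) (ν.restrict (Ioi 0)) t) t := by
  have hb : Integrable (fun r => Real.exp (t / 2 * -r)) (ν.restrict (Ioi 0)) :=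
    interior_subset (s := ProbabilityTheory.integrableExpSet (fun r => -r) (ν.restrict (Ioi 0)))
      (hν.Ioi_subset_interior_integrableExpSet (half_pos ht))
  refine (hasDerivAt_integral_of_dominated_loc_of_deriv_le (μ := ν.restrict (Ioi 0))
    (F := fun t r => (1 - Real.exp (-(r * t))) / r) (F' := fun s r => Real.exp (s * -r))
    (bound := fun r => Real.exp (t / 2 * -r))
    (Ioi_mem_nhds (half_lt_self ht))
    (Eventually.of_forall fun s => Measurable.aestronglyMeasurable (by fun_prop))
    (hν.integrableOn_one_sub_exp ht.le) (Measurable.aestronglyMeasurable (by fun_prop)) ?_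
    hb ?_).2
  · filter_upwards [ae_restrict_mem measurableSet_Ioi] with r hr s hs
    have hr' : (0 : ℝ) < r := hr
    have hs' : t / 2 < s := hs
    rw [Real.norm_of_nonneg (Real.exp_pos _).le, Real.exp_le_exp]
    nlinarith
  · filter_upwards [ae_restrict_mem measurableSet_Ioi] with r hr s hs
    have hr' : (0 : ℝ) < r := hr
    have h1 : HasDerivAt (fun s => (1 - Real.exp (-(r * s))) / r)
        (-(Real.exp (-(r * s)) * (-(r * 1))) / r) s :=
      ((((hasDerivAt_id s).const_mul r).neg.exp).const_sub 1).div_const r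
    refine h1.congr_deriv ?_
    rw [show s * -r = -(r * s) by ring]
    field_simp

/-- The Bernstein function whose Laplace transform is `f(x) / x²` is
`a + ∫ (1 - exp (-r t)) / r ν(dr)`. -/
theorem isCompleteBernstein {f : ℝ → ℝ} {a : ℝ} (ha : 0 ≤ a)
    (hf : ∀ x : ℝ, 0 < x → f x = x * (a + ∫ r in Ioi (0 : ℝ), 1 / (x + r) ∂ν)) :
    IsCompleteBernstein f := by
  have hσ := hν.sigmaFinite_restrict
  set I : ℝ → ℝ := fun t => ∫ r in Ioi (0 : ℝ), (1 - Real.exp (-(r * t))) / r ∂ν with hI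
  have hd : ∀ t : ℝ, 0 < t → HasDerivAt (fun t => a + I t)
      (ProbabilityTheory.mgf (fun r => -r) (ν.restrict (Ioi 0)) t) t := fun t ht =>
    (hν.hasDerivAt_integral_one_sub_exp ht).const_add a
  have hker : ∀ t r : ℝ, 0 < t → 0 < r → 0 ≤ (1 - Real.exp (-(r * t))) / r := fun t r ht hr => by
    have : Real.exp (-(r * t)) ≤ 1 := Real.exp_le_one_iff.2 (by have := mul_pos hr ht; linarith)
    exact div_nonneg (by linarith) hr.le
  have hI0 : ∀ t : ℝ, 0 < t → 0 ≤ I t := fun t ht =>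
    setIntegral_nonneg measurableSet_Ioi fun r hr => hker t r ht hr
  have hcont : ContinuousOn I (Ioi 0) := fun t ht =>
    (hν.hasDerivAt_integral_one_sub_exp ht).continuousAt.continuousWithinAt
  refine ⟨fun t => a + I t, ⟨fun t ht => (hd t ht).differentiableAt.differentiableWithinAt,
    fun t ht => add_nonneg ha (hI0 t ht), ?_⟩, fun x hx => ?_⟩
  · have heq : EqOn (deriv fun t => a + I t)
        (ProbabilityTheory.mgf (fun r => -r) (ν.restrict (Ioi 0))) (Ioi 0) :=
      fun t ht => (hd t ht).deriv
    refine ⟨hν.isCompletelyMonotone_mgf.1.congr heq, fun n t ht => ?_⟩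
    rw [(heq.eventuallyEq_of_mem (Ioi_mem_nhds ht)).iteratedDeriv_eq]
    exact hν.isCompletelyMonotone_mgf.2 n t ht
  · have hnn : 0 ≤ᵐ[volume.restrict (Ioi 0)] fun t => Real.exp (-(x * t)) * I t :=
      (ae_restrict_mem measurableSet_Ioi).mono fun t ht =>
        mul_nonneg (Real.exp_pos _).le (hI0 t ht)
    have hJ : IntegrableOn (fun r => 1 / x * (1 / (x + r))) (Ioi 0) ν :=
      (hν.integrableOn_one_div_add_real hx).const_mul _
    have hlint : ∫⁻ t in Ioi (0 : ℝ), ENNReal.ofReal (Real.exp (-(x * t)) * I t) =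
        ENNReal.ofReal (∫ r in Ioi (0 : ℝ), 1 / x * (1 / (x + r)) ∂ν) := by
      have e1 : ∀ t ∈ Ioi (0 : ℝ), ENNReal.ofReal (Real.exp (-(x * t)) * I t) =
          ∫⁻ r in Ioi (0 : ℝ), ENNReal.ofReal
            (Real.exp (-(x * t)) * ((1 - Real.exp (-(r * t))) / r)) ∂ν := fun t ht => by
        have ht' : (0 : ℝ) < t := ht
        rw [hI, ← integral_const_mul, ofReal_integral_eq_lintegral_ofReal]
        · exact (hν.integrableOn_one_sub_exp ht'.le).const_mul _
        · exact (ae_restrict_mem measurableSet_Ioi).mono fun r hr =>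
            mul_nonneg (Real.exp_pos _).le (hker t r ht hr)
      rw [setLIntegral_congr_fun measurableSet_Ioi e1,
        lintegral_lintegral_swap (Measurable.aemeasurable (by unfold Function.uncurry; fun_prop)),
        setLIntegral_congr_fun measurableSet_Ioi
          (fun r hr => lintegral_exp_mul_one_sub_exp hx hr),
        ofReal_integral_eq_lintegral_ofReal hJ]
      refine (ae_restrict_mem measurableSet_Ioi).mono fun r hr => ?_
      have hr' : (0 : ℝ) < r := hr
      simp only [Pi.zero_apply]; positivity
    have hm : AEStronglyMeasurable (fun t => Real.exp (-(x * t)) * I t)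
        (volume.restrict (Ioi 0)) :=
      (ContinuousOn.mul (by fun_prop) hcont).aestronglyMeasurable measurableSet_Ioi
    have hint : IntegrableOn (fun t => Real.exp (-(x * t)) * I t) (Ioi 0) := by
      refine ⟨hm, ?_⟩
      rw [hasFiniteIntegral_iff_ofReal hnn, hlint]
      exact ENNReal.ofReal_lt_top
    have hval : ∫ t in Ioi (0 : ℝ), Real.exp (-(x * t)) * I t =
        1 / x * ∫ r in Ioi (0 : ℝ), 1 / (x + r) ∂ν := by
      rw [integral_eq_lintegral_of_nonneg_ae hnn hm, hlint, ENNReal.toReal_ofReal,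
        integral_const_mul]
      refine setIntegral_nonneg measurableSet_Ioi fun r hr => ?_
      have hr' : (0 : ℝ) < r := hr
      positivity
    simp only [realLaplace, mul_add]
    refine ⟨(integrableOn_exp_neg_mul hx a).add hint, ?_⟩
    rw [integral_add (integrableOn_exp_neg_mul hx a) hint, integral_mul_const,
      integral_exp_neg_mul hx, hval, hf x hx]
    field_simp

end Viscoelastic.IsSpectralMeasure

/-! ### Limits along the positive half-line -/

namespace Viscoelastic.IsCompletelyMonotone

variable {G : ℝ → ℝ} (hG : IsCompletelyMonotone G)
include hG

theorem tendsto_ofReal_nhdsGT : Tendsto (fun t => ENNReal.ofReal (G t)) (𝓝[>] 0)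
    (𝓝 (⨆ t : Ioi (0 : ℝ), ENNReal.ofReal (G t))) := by
  have h := AntitoneOn.tendsto_nhdsGT (f := fun t => ENNReal.ofReal (G t)) (x := (0 : ℝ))
    (fun s hs t ht hst => ENNReal.ofReal_le_ofReal (hG.antitoneOn hs ht hst)) (OrderTop.bddAbove _)
  rwa [sSup_image'] at h

theorem le_realQ (hint : IntegrableOn G (Ioc 0 1)) {L : ℝ} (hL : Tendsto G atTop (𝓝 L)) {x : ℝ}
    (hx : 0 < x) : L ≤ realQ G x := by
  have h1 : ∫ t in Ioi (0 : ℝ), Real.exp (-(x * t)) * L ≤ realLaplace G x :=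
    setIntegral_mono_on (integrableOn_exp_neg_mul hx L) (hG.integrableOn_exp_mul hint hx)
      measurableSet_Ioi fun t ht =>
        mul_le_mul_of_nonneg_left (hG.le_of_tendsto hL ht) (Real.exp_pos _).le
  rw [integral_mul_const, integral_exp_neg_mul hx] at h1
  calc L = x * (1 / x * L) := by field_simp
    _ ≤ realQ G x := mul_le_mul_of_nonneg_left h1 hx.le

theorem mul_one_sub_exp_le_realQ (hint : IntegrableOn G (Ioc 0 1)) {δ x : ℝ} (hδ : 0 < δ)
    (hx : 0 < x) : G δ * (1 - Real.exp (-(x * δ))) ≤ realQ G x := by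
  have h1 : ∫ t in Ioc (0 : ℝ) δ, Real.exp (-(x * t)) * G δ ≤ realLaplace G x := by
    refine (setIntegral_mono_on ((integrableOn_exp_neg_mul hx _).mono_set Ioc_subset_Ioi_self)
      ((hG.integrableOn_exp_mul hint hx).mono_set Ioc_subset_Ioi_self) measurableSet_Ioc
      fun t ht => mul_le_mul_of_nonneg_left (hG.antitoneOn (mem_Ioi.2 ht.1) (mem_Ioi.2 hδ) ht.2)
        (Real.exp_pos _).le).trans ?_
    refine setIntegral_mono_set (hG.integrableOn_exp_mul hint hx) ?_
      Ioc_subset_Ioi_self.eventuallyLE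
    exact (ae_restrict_mem measurableSet_Ioi).mono fun t ht =>
      mul_nonneg (Real.exp_pos _).le (hG.nonneg ht)
  have h2 : ∫ t in Ioc (0 : ℝ) δ, Real.exp (-(x * t)) = (1 - Real.exp (-(x * δ))) / x := by
    rw [← intervalIntegral.integral_of_le hδ.le]
    have hd : ∀ t ∈ uIcc 0 δ, HasDerivAt (fun t => -Real.exp (-(x * t)) / x)
        (Real.exp (-(x * t))) t := fun t _ => by
      have h3 : HasDerivAt (fun t => -Real.exp (-(x * t)) / x)
          (-(Real.exp (-(x * t)) * (-(x * 1))) / x) t :=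
        ((((hasDerivAt_id t).const_mul x).neg.exp).neg).div_const x
      refine h3.congr_deriv ?_
      field_simp
    rw [intervalIntegral.integral_eq_sub_of_hasDerivAt hd
      (Continuous.intervalIntegrable (by fun_prop) _ _)]
    simp
    ring
  rw [integral_mul_const, h2] at h1
  calc G δ * (1 - Real.exp (-(x * δ))) = x * ((1 - Real.exp (-(x * δ))) / x * G δ) := by
        field_simp
    _ ≤ realQ G x := mul_le_mul_of_nonneg_left h1 hx.le

theorem ofReal_realQ_le (hint : IntegrableOn G (Ioc 0 1)) {x : ℝ} (hx : 0 < x) :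
    ENNReal.ofReal (realQ G x) ≤ ⨆ t : Ioi (0 : ℝ), ENNReal.ofReal (G t) := by
  set G₀ := ⨆ t : Ioi (0 : ℝ), ENNReal.ofReal (G t) with hG₀
  rcases eq_or_ne G₀ ∞ with h | h
  · rw [h]; exact le_top
  have hle : ∀ t : ℝ, 0 < t → G t ≤ G₀.toReal := fun t ht =>
    (ENNReal.ofReal_le_iff_le_toReal h).1
      (le_iSup (fun t : Ioi (0 : ℝ) => ENNReal.ofReal (G t)) ⟨t, ht⟩)
  refine ENNReal.ofReal_le_of_le_toReal ?_
  have h1 : realLaplace G x ≤ ∫ t in Ioi (0 : ℝ), Real.exp (-(x * t)) * G₀.toReal :=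
    setIntegral_mono_on (hG.integrableOn_exp_mul hint hx) (integrableOn_exp_neg_mul hx _)
      measurableSet_Ioi fun t ht => mul_le_mul_of_nonneg_left (hle t ht) (Real.exp_pos _).le
  rw [integral_mul_const, integral_exp_neg_mul hx] at h1
  calc realQ G x ≤ x * (1 / x * G₀.toReal) := mul_le_mul_of_nonneg_left h1 hx.le
    _ = G₀.toReal := by field_simp

/-- The initial value theorem for the Laplace transform, including the case of an infinite
limit. -/
theorem tendsto_ofReal_realQ (hint : IntegrableOn G (Ioc 0 1)) :
    Tendsto (fun x => ENNReal.ofReal (realQ G x)) atTop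
      (𝓝 (⨆ t : Ioi (0 : ℝ), ENNReal.ofReal (G t))) := by
  refine tendsto_order.2 ⟨fun c hc => ?_, fun c hc => ?_⟩
  · obtain ⟨⟨δ, hδ⟩, hcδ⟩ := lt_iSup_iff.1 hc
    have hδ' : 0 < δ := hδ
    have h1 : Tendsto (fun x => ENNReal.ofReal (G δ * (1 - Real.exp (-(x * δ))))) atTop
        (𝓝 (ENNReal.ofReal (G δ))) := by
      refine (ENNReal.continuous_ofReal.tendsto _).comp ?_
      have h2 : Tendsto (fun x : ℝ => Real.exp (-(x * δ))) atTop (𝓝 0) :=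
        Real.tendsto_exp_neg_atTop_nhds_zero.comp (tendsto_id.atTop_mul_const hδ')
      simpa using (h2.const_sub 1).const_mul (G δ)
    filter_upwards [h1.eventually_const_lt hcδ, eventually_gt_atTop 0] with x hx hx0
    exact hx.trans_le (ENNReal.ofReal_le_ofReal (hG.mul_one_sub_exp_le_realQ hint hδ' hx0))
  · filter_upwards [eventually_gt_atTop 0] with x hx
    exact (hG.ofReal_realQ_le hint hx).trans_lt hc

end Viscoelastic.IsCompletelyMonotone

/-- When `G₀ = ∞` both sides are `0`. -/
theorem tendsto_sqrt_div_sqrt {ρ : ℝ} (hρ : 0 < ρ) {q : ℝ → ℝ} (hq : ∀ x, 0 < x → 0 ≤ q x)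
    {G₀ : ℝ≥0∞} (hG₀ : 0 < G₀) (h : Tendsto (fun x => ENNReal.ofReal (q x)) atTop (𝓝 G₀)) :
    Tendsto (fun x => √ρ / √(q x)) atTop (𝓝 (frontSlowness ρ G₀)) := by
  have hρ' : ENNReal.ofReal ρ ≠ 0 := by simpa using hρ
  rcases eq_or_ne G₀ ∞ with rfl | htop
  · have h1 : frontSlowness ρ ∞ = 0 := by
      simp [frontSlowness, frontSpeed, ENNReal.top_div_of_ne_top]
    rw [h1]
    exact (Real.tendsto_sqrt_atTop.comp (ENNReal.tendsto_ofReal_nhds_top.1 h)).const_div_atTop _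
  · have hg : 0 < G₀.toReal := ENNReal.toReal_pos hG₀.ne' htop
    have h1 : frontSlowness ρ G₀ = √ρ / √(G₀.toReal) := by
      rw [frontSlowness, frontSpeed, ENNReal.toReal_inv, ← ENNReal.toReal_rpow, ENNReal.toReal_div,
        ENNReal.toReal_ofReal hρ.le, ← Real.sqrt_eq_rpow, Real.sqrt_div hg.le, inv_div]
    rw [h1]
    have h2 : Tendsto q atTop (𝓝 G₀.toReal) := by
      refine ((ENNReal.tendsto_toReal htop).comp h).congr' ?_
      filter_upwards [eventually_gt_atTop 0] with x hx
      exact ENNReal.toReal_ofReal (hq x hx)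
    exact tendsto_const_nhds.div ((Real.continuous_sqrt.tendsto _).comp h2) (Real.sqrt_pos.2 hg).ne'

/-! ### Analytic continuation -/

theorem eqOn_re_pos_of_eq_ofReal {f g : ℂ → ℂ} (hf : DifferentiableOn ℂ f {p | 0 < p.re})
    (hg : DifferentiableOn ℂ g {p | 0 < p.re}) (h : ∀ x : ℝ, 0 < x → f x = g x) :
    EqOn f g {p | 0 < p.re} := by
  have hopen : IsOpen {p : ℂ | 0 < p.re} := isOpen_lt continuous_const Complex.continuous_re
  refine (hf.analyticOnNhd hopen).eqOn_of_preconnected_of_frequently_eq (hg.analyticOnNhd hopen)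
    (convex_halfSpace_re_gt 0).isPreconnected (z₀ := 1) (by simp) ?_
  have h1 : Tendsto (fun n : ℕ => ((1 + 1 / ((n : ℝ) + 1) : ℝ) : ℂ)) atTop (𝓝[≠] 1) := by
    refine tendsto_nhdsWithin_iff.2 ⟨?_, Eventually.of_forall fun n => ?_⟩
    · have := (tendsto_one_div_add_atTop_nhds_zero_nat (𝕜 := ℝ)).const_add 1
      rw [add_zero] at this
      exact_mod_cast (Complex.continuous_ofReal.tendsto 1).comp this
    · have : (0 : ℝ) < 1 / ((n : ℝ) + 1) := by positivity
      rw [mem_compl_singleton_iff]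
      intro h0
      have h2 : (1 + 1 / ((n : ℝ) + 1)) = 1 := by exact_mod_cast h0
      linarith
  exact h1.frequently (Frequently.of_forall fun n => h _ (by positivity))

namespace Viscoelastic.IsCompletelyMonotone

variable {G : ℝ → ℝ} (hG : IsCompletelyMonotone G)
include hG

theorem integrableOn_cexp_mul (hint : IntegrableOn G (Ioc 0 1)) {p : ℂ} (hp : 0 < p.re) :
    IntegrableOn (fun t : ℝ => Complex.exp (-(p * (t : ℂ))) * ((G t : ℝ) : ℂ)) (Ioi 0) := by
  refine (hG.integrableOn_exp_mul hint hp).mono' ?_ ?_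
  · refine ContinuousOn.aestronglyMeasurable (ContinuousOn.mul (by fun_prop) ?_) measurableSet_Ioi
    exact Complex.continuous_ofReal.comp_continuousOn hG.continuousOn
  · filter_upwards [ae_restrict_mem measurableSet_Ioi] with t ht
    rw [norm_mul, Complex.norm_exp, Complex.norm_real, Real.norm_of_nonneg (hG.nonneg ht)]
    simp

/-- The Laplace transform of `G` is the complex moment generating function of `-t` under the measure
with density `G`. -/
theorem differentiableOn_laplace (hint : IntegrableOn G (Ioc 0 1)) :
    DifferentiableOn ℂ (laplace G) {p | 0 < p.re} := by
  set τ := (volume.restrict (Ioi 0)).withDensity fun t => ENNReal.ofReal (G t) with hτ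
  have hm : AEMeasurable (fun t => ENNReal.ofReal (G t)) (volume.restrict (Ioi 0)) :=
    (hG.continuousOn.aestronglyMeasurable measurableSet_Ioi).aemeasurable.ennreal_ofReal
  have hlt : ∀ᵐ t ∂volume.restrict (Ioi (0 : ℝ)), ENNReal.ofReal (G t) < ∞ :=
    Eventually.of_forall fun _ => ENNReal.ofReal_lt_top
  have hGt : ∀ t ∈ Ioi (0 : ℝ), (ENNReal.ofReal (G t)).toReal = G t := fun t ht =>
    ENNReal.toReal_ofReal (hG.nonneg ht)
  have hsub : Ioi 0 ⊆ interior (ProbabilityTheory.integrableExpSet (fun t => -t) τ) := by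
    refine isOpen_Ioi.subset_interior_iff.2 fun x hx => ?_
    rw [ProbabilityTheory.integrableExpSet, mem_ofPred_eq, hτ,
      integrable_withDensity_iff_integrable_smul₀' hm hlt]
    refine (hG.integrableOn_exp_mul hint hx).congr ?_
    filter_upwards [ae_restrict_mem measurableSet_Ioi] with t ht
    rw [hGt t ht, smul_eq_mul, mul_neg, mul_comm]
  refine (ProbabilityTheory.differentiableOn_complexMGF.mono
    (show {p : ℂ | 0 < p.re} ⊆ _ from fun p hp => hsub hp)).congr fun p _ => ?_
  rw [laplace, ProbabilityTheory.complexMGF, hτ,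
    integral_withDensity_eq_integral_toReal_smul₀ hm hlt]
  refine setIntegral_congr_fun measurableSet_Ioi fun t ht => ?_
  simp only [hGt t ht, Complex.real_smul, Complex.ofReal_neg, mul_neg]
  rw [mul_comm]

end Viscoelastic.IsCompletelyMonotone

theorem laplace_ofReal (G : ℝ → ℝ) (x : ℝ) : laplace G x = (realLaplace G x : ℂ) := by
  rw [laplace, realLaplace, ← integral_complex_ofReal]
  exact integral_congr_ae (Eventually.of_forall fun t => by push_cast; rfl)

/-! ### The square root of `Q` -/

theorem re_cpow_half_pos {q : ℂ} (hq : q ∈ Complex.slitPlane) : 0 < (q ^ (1 / 2 : ℂ)).re := by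
  rw [Complex.cpow_def_of_ne_zero (Complex.slitPlane_ne_zero hq), Complex.exp_re]
  refine mul_pos (Real.exp_pos _) (Real.cos_pos_of_mem_Ioo ?_)
  have h1 : (Complex.log q * (1 / 2)).im = q.arg / 2 := by
    rw [show (1 / 2 : ℂ) = ((1 / 2 : ℝ) : ℂ) by push_cast; rfl, Complex.im_mul_ofReal,
      Complex.log_im]
    ring
  rw [h1]
  have h2 := Complex.neg_pi_lt_arg q
  have h3 := (Complex.arg_le_pi q).lt_of_ne (Complex.mem_slitPlane_iff_arg.1 hq).1
  constructor <;> linarith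

theorem cpow_half_sq (q : ℂ) : q ^ (1 / 2 : ℂ) * q ^ (1 / 2 : ℂ) = q := by
  rw [← pow_two, ← Complex.cpow_nat_mul]
  norm_num

/-- The principal square root preserves the sign of the imaginary part. -/
theorem exists_im_cpow_half {q : ℂ} (hq : q ∈ Complex.slitPlane) :
    ∃ c : ℝ, 0 < c ∧ (q ^ (1 / 2 : ℂ)).im = c * q.im := by
  have h := re_cpow_half_pos hq
  refine ⟨1 / (2 * (q ^ (1 / 2 : ℂ)).re), by positivity, ?_⟩
  have h2 := congrArg Complex.im (cpow_half_sq q)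
  rw [Complex.mul_im] at h2
  rw [← h2]
  field_simp
  ring

theorem ofReal_cpow_half {x : ℝ} (hx : 0 ≤ x) : (x : ℂ) ^ (1 / 2 : ℂ) = (√x : ℂ) := by
  rw [Real.sqrt_eq_rpow, Complex.ofReal_cpow hx]
  norm_num

/-- The function `a p + c + b(p)` maps the slit plane to itself and each half-plane into its
closure. -/
theorem Viscoelastic.IsSpectralMeasure.mem_slitPlane_and_exists_im {ν : Measure ℝ}
    (hν : IsSpectralMeasure ν) {a c : ℝ} (ha : 0 ≤ a)
    (hpos : ∀ x : ℝ, 0 < x → 0 < ((a : ℂ) * x + c + b ν x).re) {p : ℂ}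
    (hp : p ∈ Complex.slitPlane) :
    (a : ℂ) * p + c + b ν p ∈ Complex.slitPlane ∧
      ∃ k : ℝ, 0 ≤ k ∧ ((a : ℂ) * p + c + b ν p).im = k * p.im := by
  set J := ∫ r in Ioi (0 : ℝ), r / ‖p + (r : ℂ)‖ ^ 2 ∂ν with hJ
  have hnn : 0 ≤ᵐ[ν.restrict (Ioi 0)] fun r : ℝ => r / ‖p + (r : ℂ)‖ ^ 2 :=
    (ae_restrict_mem measurableSet_Ioi).mono fun r (hr : 0 < r) => by
      simp only [Pi.zero_apply]; positivity
  have hJ0 : 0 ≤ J := integral_nonneg_of_ae hnn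
  have him : ((a : ℂ) * p + c + b ν p).im = (a + J) * p.im := by
    rw [Complex.add_im, Complex.add_im, Complex.im_ofReal_mul, Complex.ofReal_im, hν.im_b hp, ← hJ]
    ring
  refine ⟨?_, a + J, by positivity, him⟩
  by_cases h0 : p.im = 0
  · have hx : 0 < p.re := by
      rcases Complex.mem_slitPlane_iff.1 hp with h | h
      · exact h
      · exact absurd h0 h
    have hpe : p = (p.re : ℂ) := Complex.ext rfl (by simpa using h0)
    exact Complex.mem_slitPlane_iff.2 (Or.inl (by rw [hpe]; exact hpos _ hx))
  · by_cases hk : a + J = 0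
    · -- the imaginary part vanishes only if the function is the positive constant `c`
      have ha' : a = 0 := by linarith
      have hJ' : J = 0 := by linarith
      have hae := (integral_eq_zero_iff_of_nonneg_ae hnn (hν.integrableOn_im hp)).1 (hJ ▸ hJ')
      have hzero : ν.restrict (Ioi 0) = 0 := by
        rw [← ae_eq_bot, ← eventually_false_iff_eq_bot]
        filter_upwards [hae, ae_restrict_mem measurableSet_Ioi] with r hr hr0
        have hr0' : (0 : ℝ) < r := hr0
        have h1 : p + (r : ℂ) ≠ 0 := fun h2 => h0 (by simpa using congrArg Complex.im h2)
        have h3 : 0 < r / ‖p + (r : ℂ)‖ ^ 2 := by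
          have := norm_pos_iff.2 h1
          positivity
        exact h3.ne' hr
      have hb : ∀ q, b ν q = 0 := fun q => by rw [b, hzero]; simp
      have hc := hpos 1 one_pos
      rw [ha', hb] at hc ⊢
      simp only [Complex.ofReal_zero, zero_mul, zero_add, add_zero, Complex.ofReal_re] at hc ⊢
      exact Complex.ofReal_mem_slitPlane.2 hc
    · exact Complex.mem_slitPlane_iff.2 (Or.inr (by rw [him]; exact mul_ne_zero hk h0))

/-- `Q` extends from the right half-plane to the slit plane in the form `a p + c + b(p)`. -/
theorem exists_Q_eq {G : ℝ → ℝ} (hG : IsCompletelyMonotone G) (hint : IntegrableOn G (Ioc 0 1))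
    {L : ℝ} (hL : Tendsto G atTop (𝓝 L)) :
    ∃ (a c : ℝ) (ν : Measure ℝ), 0 ≤ a ∧ IsSpectralMeasure ν ∧
      (∀ x : ℝ, 0 < x → (a : ℂ) * x + c + b ν x = (realQ G x : ℂ)) ∧
      ∀ p : ℂ, 0 < p.re → Q G p = (a : ℂ) * p + c + b ν p := by
  obtain ⟨m, hm, hmeq⟩ := exists_realLaplace_eq_integral_stieltjesKernel hG hint hL
  obtain ⟨a, c, ν, ha, -, hν, h⟩ := exists_spectralMeasure_of_measure_unitInterval m
  have hreal : ∀ x : ℝ, 0 < x → (a : ℂ) * x + c + b ν x = (realQ G x : ℂ) := fun x hx => by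
    rw [b_ofReal, realQ, ← hmeq ⟨x, hx⟩, h ⟨x, hx⟩]
    have : (x : ℂ) ≠ 0 := by exact_mod_cast hx.ne'
    push_cast
    field_simp
  have hsub : {p : ℂ | 0 < p.re} ⊆ Complex.slitPlane := fun p hp => Or.inl hp
  refine ⟨a, c, ν, ha, hν, hreal, eqOn_re_pos_of_eq_ofReal ?_ ?_ fun x hx => ?_⟩
  · exact differentiableOn_id.mul (hG.differentiableOn_laplace hint)
  · exact ((differentiableOn_id.const_mul _).add_const _).add (hν.differentiableOn_b.mono hsub)
  · rw [hreal x hx, Q, laplace_ofReal, realQ, Complex.ofReal_mul]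

/-! ### The representation of `B` -/

/-- The Stieltjes representation of `√ρ / √Q`, with its constant and its spectral measure. -/
theorem exists_sqrt_div_sqrt_realQ_eq {ρ : ℝ} (hρ : 0 < ρ) {G : ℝ → ℝ}
    (hG : IsCompletelyMonotone G) (hint : IntegrableOn G (Ioc 0 1)) {L : ℝ}
    (hL : Tendsto G atTop (𝓝 L)) (hL0 : 0 < L) :
    ∃ (a c : ℝ) (ν : Measure ℝ), 0 ≤ a ∧ 0 ≤ c ∧ IsSpectralMeasure ν ∧ ∀ x : ℝ, 0 < x →
      √ρ / √(realQ G x) = a + c / x + ∫ r in Ioi (0 : ℝ), 1 / (x + r) ∂ν := by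
  obtain ⟨a, c, ν, ha, hν, hreal, -⟩ := exists_Q_eq hG hint hL
  have hQpos : ∀ x : ℝ, 0 < x → 0 < realQ G x := fun x hx =>
    hL0.trans_le (hG.le_realQ hint hL hx)
  have hpos : ∀ x : ℝ, 0 < x → 0 < ((a : ℂ) * x + c + b ν x).re := fun x hx => by
    rw [hreal x hx, Complex.ofReal_re]; exact hQpos x hx
  set q : ℂ → ℂ := fun p => (a : ℂ) * p + c + b ν p with hq
  have hmem : ∀ p ∈ Complex.slitPlane, q p ∈ Complex.slitPlane := fun p hp =>
    (hν.mem_slitPlane_and_exists_im ha hpos hp).1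
  have hqd : DifferentiableOn ℂ q Complex.slitPlane :=
    ((differentiableOn_id.const_mul _).add_const _).add hν.differentiableOn_b
  have hne : ∀ p ∈ Complex.slitPlane, q p ^ (1 / 2 : ℂ) ≠ 0 := fun p hp h0 => by
    have := re_cpow_half_pos (hmem p hp)
    rw [h0] at this
    simp at this
  set S : ℂ → ℂ := fun p => (√ρ : ℂ) / q p ^ (1 / 2 : ℂ) with hS
  have hSd : DifferentiableOn ℂ S Complex.slitPlane :=
    (differentiableOn_const _).div (hqd.cpow (differentiableOn_const _) hmem) hne
  have hSim : ∀ p ∈ Complex.slitPlane, ∃ k : ℝ, 0 ≤ k ∧ (S p).im = -(k * p.im) := fun p hp => by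
    obtain ⟨k₁, hk₁, h₁⟩ := (hν.mem_slitPlane_and_exists_im ha hpos hp).2
    obtain ⟨k₂, hk₂, h₂⟩ := exists_im_cpow_half (hmem p hp)
    refine ⟨√ρ * (k₂ * k₁) / Complex.normSq (q p ^ (1 / 2 : ℂ)), ?_, ?_⟩
    · have := Complex.normSq_nonneg (q p ^ (1 / 2 : ℂ))
      positivity
    · simp only [hS]
      rw [Complex.div_im, h₂, Complex.ofReal_re, Complex.ofReal_im]
      simp only [hq] at h₁ ⊢
      rw [h₁]
      ring
  have hslit : ∀ p : ℂ, p.im ≠ 0 → p ∈ Complex.slitPlane := fun p hp => Or.inr hp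
  have hSre : ∀ x : ℝ, 0 < x → (S x).re = √ρ / √(realQ G x) := fun x hx => by
    simp only [hS, hq]
    rw [hreal x hx, ofReal_cpow_half (hQpos x hx).le, ← Complex.ofReal_div, Complex.ofReal_re]
  obtain ⟨μ, hμ, hμeq⟩ := exists_integral_stieltjesKernel_eq hSd
    (fun p hp => by
      obtain ⟨k, hk, h⟩ := hSim p (hslit p hp.ne')
      rw [h]
      exact neg_nonpos.2 (mul_nonneg hk hp.le))
    (fun p hp => by
      obtain ⟨k, hk, h⟩ := hSim p (hslit p hp.ne)
      rw [h]
      exact neg_nonneg.2 (mul_nonpos_of_nonneg_of_nonpos hk hp.le))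
    (fun x hx => by rw [hSre x hx]; positivity)
  obtain ⟨a', c', ν', ha', hc', hν', h'⟩ := exists_spectralMeasure_of_measure_unitInterval μ
  exact ⟨a', c', ν', ha', hc', hν', fun x hx => by
    rw [← hSre x hx, ← hμeq ⟨x, hx⟩, h' ⟨x, hx⟩]⟩

theorem tendsto_realB_nhdsGT {ρ : ℝ} {G : ℝ → ℝ} (hG : IsCompletelyMonotone G)
    (hint : IntegrableOn G (Ioc 0 1)) {L : ℝ} (hL : Tendsto G atTop (𝓝 L)) (hL0 : 0 < L) :
    Tendsto (realB ρ G) (𝓝[>] 0) (𝓝 0) := by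
  have h1 : Tendsto (fun x : ℝ => x * √ρ / √L) (𝓝[>] 0) (𝓝 0) := by
    have h2 : Continuous fun x : ℝ => x * √ρ / √L := by fun_prop
    simpa using (h2.tendsto 0).mono_left nhdsWithin_le_nhds
  refine squeeze_zero' ?_ ?_ h1
  · filter_upwards [self_mem_nhdsWithin] with x hx
    have hx' : (0 : ℝ) < x := hx
    rw [realB]; positivity
  · filter_upwards [self_mem_nhdsWithin] with x hx
    have hx' : (0 : ℝ) < x := hx
    rw [realB]
    have := Real.sqrt_pos.2 hL0
    gcongr
    exact hG.le_realQ hint hL hx'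

/-- The representation of `B` on the half-line: the `1 / x` term vanishes because `B(0+) = 0`, and
the constant is the limit of `B(x) / x`. -/
theorem exists_realB_eq {ρ : ℝ} (hρ : 0 < ρ) {G : ℝ → ℝ}
    (hG : IsCompletelyMonotone G) (hint : IntegrableOn G (Ioc 0 1)) {L : ℝ}
    (hL : Tendsto G atTop (𝓝 L)) (hL0 : 0 < L) {a : ℝ}
    (ha : Tendsto (fun x : ℝ => realB ρ G x / x) atTop (𝓝 a)) :
    ∃ ν : Measure ℝ, IsSpectralMeasure ν ∧ 0 ≤ a ∧ ∀ x : ℝ, 0 < x →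
      realB ρ G x = x * (a + ∫ r in Ioi (0 : ℝ), 1 / (x + r) ∂ν) := by
  obtain ⟨a', c, ν, ha', hc, hν, h⟩ := exists_sqrt_div_sqrt_realQ_eq hρ hG hint hL hL0
  have hB : ∀ x : ℝ, 0 < x → realB ρ G x =
      x * (a' + c / x + ∫ r in Ioi (0 : ℝ), 1 / (x + r) ∂ν) := fun x hx => by
    rw [← h x hx, realB, mul_div_assoc]
  have hI : ∀ x : ℝ, 0 < x → 0 ≤ ∫ r in Ioi (0 : ℝ), 1 / (x + r) ∂ν := fun x hx =>
    setIntegral_nonneg measurableSet_Ioi fun r (hr : 0 < r) => by positivity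
  have hc0 : c = 0 := by
    refine le_antisymm ?_ hc
    refine ge_of_tendsto (tendsto_realB_nhdsGT (ρ := ρ) hG hint hL hL0) ?_
    filter_upwards [self_mem_nhdsWithin] with x hx
    have hx' : (0 : ℝ) < x := hx
    rw [hB x hx']
    calc c = x * (c / x) := by field_simp
      _ ≤ _ := mul_le_mul_of_nonneg_left (by linarith [hI x hx']) hx'.le
  have haa : a = a' := by
    refine tendsto_nhds_unique ha ?_
    have h1 := hν.tendsto_integral_atTop.const_add a'
    rw [add_zero] at h1
    refine h1.congr' ?_
    filter_upwards [eventually_gt_atTop 0] with x hx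
    rw [hB x hx, hc0, zero_div, add_zero]
    field_simp
  subst haa
  refine ⟨ν, hν, ha', fun x hx => ?_⟩
  rw [hB x hx, hc0, zero_div, add_zero]

theorem mainTheorem3 (ρ : ℝ) (hρ : 0 < ρ) (G : ℝ → ℝ)
    (hG : IsCompletelyMonotone G) (hint : IntegrableOn G (Ioc 0 1))
    (Ginf : ℝ) (hlim : Tendsto G atTop (𝓝 Ginf)) (hGinf : 0 < Ginf) :
    -- the Laplace transform converges, and the principal root of `Q` is analytic and non-zero
    (∀ p : ℂ, 0 < p.re →
      IntegrableOn (fun t : ℝ => Complex.exp (-(p * (t : ℂ))) * ((G t : ℝ) : ℂ)) (Ioi 0) ∧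
        Q G p ∈ Complex.slitPlane) ∧
    -- the real and the complex `B` agree on `]0,∞[`
    (∀ x : ℝ, 0 < x → B ρ G (x : ℂ) = ((realB ρ G x : ℝ) : ℂ)) ∧
    IsCompleteBernstein (realB ρ G) ∧
    Tendsto (realB ρ G) (𝓝[>] 0) (𝓝 0) ∧
    ∃ G₀ : ℝ≥0∞, Tendsto (fun t : ℝ => ENNReal.ofReal (G t)) (𝓝[>] 0) (𝓝 G₀) ∧ 0 < G₀ ∧
      Tendsto (fun x : ℝ => realB ρ G x / x) atTop (𝓝 (frontSlowness ρ G₀)) ∧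
      ∃ ν : Measure ℝ, IsSpectralMeasure ν ∧
        (∀ p ∈ Complex.slitPlane, IntegrableOn (fun r : ℝ => 1 / (p + (r : ℂ))) (Ioi 0) ν) ∧
        -- `B(p) = p / c₀ + b(p)`, and the right-hand side continues `B` analytically
        (∀ p : ℂ, 0 < p.re → B ρ G p = ((frontSlowness ρ G₀ : ℝ) : ℂ) * p + b ν p) ∧
        DifferentiableOn ℂ (b ν) Complex.slitPlane ∧
        -- `b(p) = o(p)` as `p → ∞` in the closed right half-plane
        (b ν =o[Bornology.cobounded ℂ ⊓ 𝓟 {p : ℂ | 0 ≤ p.re}] fun p : ℂ => p) ∧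
        (∀ p : ℂ, 0 ≤ p.re → 0 ≤ attenuation ν p) ∧
        -- attenuation and dispersion on the closed right half-plane
        (∀ p : ℂ, 0 ≤ p.re → p ≠ 0 →
          IntegrableOn (fun r : ℝ => (‖p‖ ^ 2 + r * p.re) / ‖p + (r : ℂ)‖ ^ 2) (Ioi 0) ν ∧
          attenuation ν p =
            ∫ r in Ioi (0 : ℝ), (‖p‖ ^ 2 + r * p.re) / ‖p + (r : ℂ)‖ ^ 2 ∂ν ∧
          IntegrableOn (fun r : ℝ => r / ‖p + (r : ℂ)‖ ^ 2) (Ioi 0) ν ∧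
          dispersion ν p = -p.im * ∫ r in Ioi (0 : ℝ), r / ‖p + (r : ℂ)‖ ^ 2 ∂ν) ∧
        -- attenuation and dispersion at a real frequency `ω`, where `p = -i ω`
        (∀ ω : ℝ, ω ≠ 0 →
          IntegrableOn (fun r : ℝ => 1 / (ω ^ 2 + r ^ 2)) (Ioi 0) ν ∧
          attenuation ν (-Complex.I * (ω : ℂ)) =
            ω ^ 2 * ∫ r in Ioi (0 : ℝ), 1 / (ω ^ 2 + r ^ 2) ∂ν ∧
          IntegrableOn (fun r : ℝ => r / (ω ^ 2 + r ^ 2)) (Ioi 0) ν ∧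
          dispersion ν (-Complex.I * (ω : ℂ)) =
            ω * ∫ r in Ioi (0 : ℝ), r / (ω ^ 2 + r ^ 2) ∂ν) := by
  have hQpos : ∀ x : ℝ, 0 < x → 0 < realQ G x := fun x hx =>
    hGinf.trans_le (hG.le_realQ hint hlim hx)
  obtain ⟨a, c, ν₁, ha, hν₁, hreal, hQ⟩ := exists_Q_eq hG hint hlim
  have hsub : {p : ℂ | 0 < p.re} ⊆ Complex.slitPlane := fun p hp => Or.inl hp
  have hQslit : ∀ p : ℂ, 0 < p.re → Q G p ∈ Complex.slitPlane := fun p hp => by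
    rw [hQ p hp]
    refine (hν₁.mem_slitPlane_and_exists_im ha (fun x hx => ?_) (hsub hp)).1
    rw [hreal x hx, Complex.ofReal_re]
    exact hQpos x hx
  have hBreal : ∀ x : ℝ, 0 < x → B ρ G (x : ℂ) = ((realB ρ G x : ℝ) : ℂ) := fun x hx => by
    rw [B, hQ x (by simpa using hx), hreal x hx, ofReal_cpow_half (hQpos x hx).le, realB]
    push_cast
    rfl
  have hG₀lim := hG.tendsto_ofReal_nhdsGT
  have hQlim := hG.tendsto_ofReal_realQ hint
  set G₀ : ℝ≥0∞ := ⨆ t : Ioi (0 : ℝ), ENNReal.ofReal (G t) with hG₀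
  have hG₀pos : 0 < G₀ :=
    (ENNReal.ofReal_pos.2 (hGinf.trans_le (hG.le_of_tendsto hlim one_pos))).trans_le
      (le_iSup (fun t : Ioi (0 : ℝ) => ENNReal.ofReal (G t)) ⟨1, mem_Ioi.2 one_pos⟩)
  have hBlim : Tendsto (fun x : ℝ => realB ρ G x / x) atTop (𝓝 (frontSlowness ρ G₀)) := by
    refine (tendsto_sqrt_div_sqrt hρ (fun x hx => (hQpos x hx).le) hG₀pos hQlim).congr' ?_
    filter_upwards [eventually_gt_atTop 0] with x hx
    rw [realB]
    field_simp
  obtain ⟨ν, hν, hs, hB⟩ := exists_realB_eq hρ hG hint hlim hGinf hBlim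
  have hBeq : EqOn (B ρ G) (fun p => ((frontSlowness ρ G₀ : ℝ) : ℂ) * p + b ν p)
      {p | 0 < p.re} := by
    refine eqOn_re_pos_of_eq_ofReal ?_ ?_ fun x hx => ?_
    · have hQd : DifferentiableOn ℂ (Q G) {p | 0 < p.re} :=
        differentiableOn_id.mul (hG.differentiableOn_laplace hint)
      refine (differentiableOn_id.mul_const _).div (hQd.cpow (differentiableOn_const _) hQslit)
        fun p hp h0 => ?_
      have := re_cpow_half_pos (hQslit p hp)
      rw [h0] at this
      simp at this
    · exact (differentiableOn_id.const_mul _).add (hν.differentiableOn_b.mono hsub)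
    · rw [hBreal x hx, hB x hx, b_ofReal]
      push_cast
      ring
  have hri : ∀ p : ℂ, 0 ≤ p.re → p ≠ 0 →
      IntegrableOn (fun r : ℝ => (‖p‖ ^ 2 + r * p.re) / ‖p + (r : ℂ)‖ ^ 2) (Ioi 0) ν ∧
      attenuation ν p =
        ∫ r in Ioi (0 : ℝ), (‖p‖ ^ 2 + r * p.re) / ‖p + (r : ℂ)‖ ^ 2 ∂ν ∧
      IntegrableOn (fun r : ℝ => r / ‖p + (r : ℂ)‖ ^ 2) (Ioi 0) ν ∧
      dispersion ν p = -p.im * ∫ r in Ioi (0 : ℝ), r / ‖p + (r : ℂ)‖ ^ 2 ∂ν := fun p hp h0 => by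
    have hm := mem_slitPlane_of_re_nonneg hp h0
    refine ⟨hν.integrableOn_re hm, hν.re_b hm, hν.integrableOn_im hm, ?_⟩
    rw [dispersion, hν.im_b hm, neg_mul]
  refine ⟨fun p hp => ⟨hG.integrableOn_cexp_mul hint hp, hQslit p hp⟩, hBreal,
    hν.isCompleteBernstein hs hB, tendsto_realB_nhdsGT hG hint hlim hGinf,
    G₀, hG₀lim, hG₀pos, hBlim, ν, hν, fun p hp => hν.integrableOn_one_div_add hp,
    fun p hp => hBeq hp, hν.differentiableOn_b, hν.isLittleO_b,
    fun p hp => hν.re_b_nonneg hp, hri, fun ω hω => ?_⟩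
  have hre : (-Complex.I * (ω : ℂ)).re = 0 := by simp
  have him : (-Complex.I * (ω : ℂ)).im = -ω := by simp
  have hnorm : ‖-Complex.I * (ω : ℂ)‖ ^ 2 = ω ^ 2 := by simp
  have hnormr : ∀ r : ℝ, ‖-Complex.I * (ω : ℂ) + (r : ℂ)‖ ^ 2 = ω ^ 2 + r ^ 2 := fun r => by
    rw [← Complex.normSq_eq_norm_sq, Complex.normSq_apply]
    simp
    ring
  obtain ⟨h1, h2, h3, h4⟩ := hri (-Complex.I * (ω : ℂ)) hre.ge
    (mul_ne_zero (neg_ne_zero.2 Complex.I_ne_zero) (by exact_mod_cast hω))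
  simp only [hre, him, hnorm, hnormr, mul_zero, add_zero, neg_neg] at h1 h2 h3 h4
  refine ⟨?_, ?_, h3, h4⟩
  · refine (h1.const_mul (ω ^ 2)⁻¹).congr (Eventually.of_forall fun r => ?_)
    have : ω ^ 2 ≠ 0 := pow_ne_zero 2 hω
    simp only
    field_simp
  · rw [h2, ← integral_const_mul]
    simp only [mul_one_div]
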